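/- **Setting.** Let $n\in\mathbb N$, let $p\ge 4$ be even and $p'=p+2$. Let $f\in C^p(\mathbb R^n)$ be bounded below, with $\|\nabla^p f(y)-\nabla^p f(z)\|\le (p-1)!\,L\,\|y-z\|$ for all $y,z$, where $L>0$ and the norm of a $j$-tensor is $\|T\|=\max_{\|v_1\|=\dots=\|v_j\|=1}|T[v_1,\dots,v_j]|$. Let $0<\epsilon<1$, $a\in[0,\frac12]$, $\delta=\epsilon^a$, $\sigma_{\min}>0$, $0<\eta<1$, $\gamma_1>1>\gamma_2>0$. A polynomial is *SoS-convex* if its Hessian has the form $V(s)^TV(s)$ with a polynomial matrix $V$. Let $T_p(x,s)=f(x)+\sum_{j=1}^p\frac1{j!}\nabla^jf(x)[s]^j$ and $$m_{x,\sigma}(s)=T_p(x,s)+\frac c2\|s\|^2+\frac{\sigma}{p'}\|s\|^{p'},$$ where, with $\lambda=\lambda_{\min}[\nabla^2f(x)]$, $c=0$ if $\lambda\ge\delta$; $c=-\lambda+\delta$ if $\lambda\le0$; $c=\delta$ if $0<\lambda\le\delta$ (for $\lambda=\delta$ either choice is allowed). *Algorithm (AR$p$+SoS).* Start with $x_0=0$,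 $\sigma^r_0=\sigma_{\min}$. At iteration $k$, terminate if $\|\nabla f(x_k)\|\le\epsilon$. Otherwise let $\bar\sigma_k$ be the least $\sigma\ge0$ for which $m_{x_k,\sigma}$ is SoS-convex, put $\sigma_k=\max\{\bar\sigma_k,\sigma_k^r\}$, let $s_k$ be a global minimizer of $m_{x_k,\sigma_k}$ and $\rho_k=\frac{f(x_k)-f(x_k+s_k)}{f(x_k)-T_p(x_k,s_k)}$. If $\rho_k>\eta$ (successful iteration), set $x_{k+1}=x_k+s_k$, $\sigma^r_{k+1}=\max\{\gamma_2\sigma_k,\sigma_{\min}\}$; otherwise set $x_{k+1}=x_k$, $\sigma^r_{k+1}=\gamma_1\sigma_k$. Assume $\|\nabla^jf(x_k)\|\le\Lambda_j$ for $j=1,\dots,p$ and all iterates $x_k$ of iterations that are carried out. Put $$A_0=\frac{Lp'}{(p+1)(1-\eta)},\qquad B=4A_0\max\{1,\Lambda_2+1,(L+A_0)^{1/p}\},\qquad B'=A_0\Big(1+2\Lambda_2+\sum_{j=3}^p\Lambda_j+A_0\Big).$$ **Theorem (upper bound for $\sigma_k$ when $p$ is even).** There is a constant $R>0$, depending only on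 $n$ and $p$, such that $\|s\|^2+\|s\|^{p'}+q(s)$ is SoS-convex for every polynomial $q$ in $n$ variables of degree at most $p$ whose coefficients in the monomial basis are at most $R$ in absolute value. For every such $R$, with $C_R=\frac{p'}2\big(\sum_{j=3}^p\frac{2\Lambda_j}R\big)^{p'-2}$, the following holds for every run of the algorithm and every iteration $k\ge0$ that is carried out: $$\sigma_k\le\max\Big\{\sigma_0,\ \gamma_1B'\epsilon^{-1},\ p'\tfrac\delta2,\ C_R\,\delta^{3-p'}\Big\},$$ $$\sigma_k\le\tilde C_R\max\{\epsilon^{-1},\epsilon^{a(1-p)}\}=\tilde C_R\,\epsilon^{-\max\{1,a(p-1)\}},\qquad \tilde C_R=\max\{\sigma_0,\gamma_1B',p'\tfrac\delta2,C_R\}.$$ In particular $\sigma_k\le\tilde C_R\epsilon^{-1}$ if $a\in[0,\frac1{p-1}]$, and $\sigma_k\le\tilde C_R\epsilon^{a(1-p)}$ if $a\in[\frac1{p-1},\frac12]$. If, moreover, $\|\nabla f(x_k+s_k)\|>\epsilon$ at every unsuccessful iteration $k$ that is carried out, then all these bounds also hold with $B$ in place of $B'$. -/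

import Mathlib

noncomputable section

namespace ARpSoS

/-! ### SoS-convex polynomials -/

/-- The Hessian (a matrix of polynomials) of a real polynomial in `n` variables. -/
def polyHessian {n : ℕ} (P : MvPolynomial (Fin n) ℝ) :
    Matrix (Fin n) (Fin n) (MvPolynomial (Fin n) ℝ) :=
  Matrix.of fun i j => MvPolynomial.pderiv i (MvPolynomial.pderiv j P)

/-- A polynomial matrix `H(s)` is an SoS-matrix if `H(s) = V(s)ᵀ V(s)` for some polynomial matrix
`V(s)` with `n` columns and finitely many rows. -/
def IsSoSMatrix {n : ℕ} (H : Matrix (Fin n) (Fin n) (MvPolynomial (Fin n) ℝ)) : Prop :=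
  ∃ (m : ℕ) (V : Matrix (Fin m) (Fin n) (MvPolynomial (Fin n) ℝ)), H = V.transpose * V

/-- A function `q : ℝⁿ → ℝ` is an SoS-convex polynomial if it is given by a polynomial (necessarily
unique, `ℝ` being infinite) whose Hessian is an SoS-matrix. -/
def IsSoSConvex {n : ℕ} (q : EuclideanSpace ℝ (Fin n) → ℝ) : Prop :=
  ∃ P : MvPolynomial (Fin n) ℝ,
    (∀ s, MvPolynomial.eval (fun i => s i) P = q s) ∧ IsSoSMatrix (polyHessian P)

/-- The order of the regularization: `p' = p + 1` for odd `p`, `p' = p + 2` for even `p`. -/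
def regOrder (p : ℕ) : ℕ := if Even p then p + 2 else p + 1

/-- `R > 0` is such that `‖s‖² + ‖s‖^{p'} + q(s)` is SoS-convex for all polynomials `q` of degree at
most `p` whose coefficients in the monomial basis are all at most `R` in absolute value. -/
def IsSoSRadius (n p : ℕ) (R : ℝ) : Prop :=
  0 < R ∧ ∀ q : MvPolynomial (Fin n) ℝ, q.totalDegree ≤ p → (∀ m, |q.coeff m| ≤ R) →
    IsSoSConvex fun s : EuclideanSpace ℝ (Fin n) =>
      ‖s‖ ^ 2 + ‖s‖ ^ regOrder p + MvPolynomial.eval (fun i => s i) q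

/-! ### The SoS Taylor model -/

/-- The `p`-th order Taylor model `T_p(x, s)` of `f` at `x`. -/
def taylorModel {n : ℕ} (f : EuclideanSpace ℝ (Fin n) → ℝ) (p : ℕ)
    (x s : EuclideanSpace ℝ (Fin n)) : ℝ :=
  f x + ∑ j ∈ Finset.Icc 1 p, (1 / (j.factorial : ℝ)) * iteratedFDeriv ℝ j f x (fun _ => s)

/-- The Hessian matrix of `f` at `x`. -/
def hessianMatrix {n : ℕ} (f : EuclideanSpace ℝ (Fin n) → ℝ) (x : EuclideanSpace ℝ (Fin n)) :
    Matrix (Fin n) (Fin n) ℝ :=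
  Matrix.of fun i j =>
    iteratedFDeriv ℝ 2 f x ![EuclideanSpace.single i (1 : ℝ), EuclideanSpace.single j (1 : ℝ)]

/-- The smallest eigenvalue of the Hessian of `f` at `x`. -/
def hessianLambdaMin {n : ℕ} (f : EuclideanSpace ℝ (Fin n) → ℝ) (x : EuclideanSpace ℝ (Fin n)) :
    ℝ :=
  sInf (spectrum ℝ (hessianMatrix f x))

/-- `IsPerturbation lam δ c`: if the smallest eigenvalue of the Hessian is `lam`, then the model
carries the perturbation `(c / 2) ‖s‖²`. The three alternatives are the locally strongly convex, the
locally nonconvex and the locally nearly strongly convex case; for `lam = δ` both the first and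
the third description apply, and either choice is allowed. -/
def IsPerturbation (lam δ c : ℝ) : Prop :=
  (δ ≤ lam ∧ c = 0) ∨ (lam ≤ 0 ∧ c = -lam + δ) ∨ (0 < lam ∧ lam ≤ δ ∧ c = δ)

/-- The SoS Taylor model
`m_c(x, s) = T_p(x, s) + (c / 2) ‖s‖² + (σ / p') ‖s‖^{p'}`. -/
def sosTaylorModel {n : ℕ} (f : EuclideanSpace ℝ (Fin n) → ℝ) (p : ℕ)
    (x : EuclideanSpace ℝ (Fin n)) (c σ : ℝ) (s : EuclideanSpace ℝ (Fin n)) : ℝ :=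
  taylorModel f p x s + c / 2 * ‖s‖ ^ 2 + σ / (regOrder p : ℝ) * ‖s‖ ^ regOrder p

/-- The value of the sum of squares program: the smallest `σ ≥ 0` for which the model is
SoS-convex. -/
def sosSigma {n : ℕ} (f : EuclideanSpace ℝ (Fin n) → ℝ) (p : ℕ)
    (x : EuclideanSpace ℝ (Fin n)) (c : ℝ) : ℝ :=
  sInf {σ : ℝ | 0 ≤ σ ∧ IsSoSConvex (sosTaylorModel f p x c σ)}

/-! ### The algorithm AR`p`+SoS -/

/-- The ratio of actual to predicted decrease. -/
def decreaseRatio {n : ℕ} (f : EuclideanSpace ℝ (Fin n) → ℝ) (p : ℕ)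
    (x s : EuclideanSpace ℝ (Fin n)) : ℝ :=
  (f x - f (x + s)) / (f x - taylorModel f p x s)

/-- Iteration `k` is carried out: the termination test `‖∇f(x_j)‖ ≤ ε` has failed for all
`j ≤ k`. -/
def Performed {n : ℕ} (f : EuclideanSpace ℝ (Fin n) → ℝ) (ε : ℝ)
    (x : ℕ → EuclideanSpace ℝ (Fin n)) (k : ℕ) : Prop :=
  ∀ j ≤ k, ε < ‖gradient f (x j)‖

/-- The sequences `x, s, σr, σ, c` record a run of the algorithm AR`p`+SoS with tolerance `ε` and
parameters `δ, σmin, η, γ₁, γ₂`: iterates, steps, the regularization parameters `σʳ_k` and `σ_k`,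
and the coefficient of the quadratic perturbation. Entries that belong to iterations which are not
carried out are unconstrained. -/
structure IsRun {n : ℕ} (f : EuclideanSpace ℝ (Fin n) → ℝ) (p : ℕ)
    (ε δ σmin η γ₁ γ₂ : ℝ) (x s : ℕ → EuclideanSpace ℝ (Fin n)) (σr σ c : ℕ → ℝ) : Prop where
  x_zero : x 0 = 0
  reg_zero : σr 0 = σmin
  perturbation : ∀ k, Performed f ε x k → IsPerturbation (hessianLambdaMin f (x k)) δ (c k)
  sigma_eq : ∀ k, Performed f ε x k → σ k = max (sosSigma f p (x k) (c k)) (σr k)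
  step_min : ∀ k, Performed f ε x k →
    ∀ v, sosTaylorModel f p (x k) (c k) (σ k) (s k) ≤ sosTaylorModel f p (x k) (c k) (σ k) v
  successful : ∀ k, Performed f ε x k → η < decreaseRatio f p (x k) (s k) →
    x (k + 1) = x k + s k ∧ σr (k + 1) = max (γ₂ * σ k) σmin
  unsuccessful : ∀ k, Performed f ε x k → ¬ η < decreaseRatio f p (x k) (s k) →
    x (k + 1) = x k ∧ σr (k + 1) = γ₁ * σ k

/-! ### The constants -/

/-- `A₀ = L p' / ((p + 1) (1 - η))`. -/
def constA (p : ℕ) (L η : ℝ) : ℝ := L * (regOrder p : ℝ) / (((p : ℝ) + 1) * (1 - η))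

/-- `B = 4 A₀ max {1, Λ₂ + 1, (L + A₀)^{1/p}}`. -/
def constB (p : ℕ) (L η : ℝ) (Λ : ℕ → ℝ) : ℝ :=
  4 * constA p L η * max 1 (max (Λ 2 + 1) ((L + constA p L η) ^ (1 / (p : ℝ))))

/-- `B' = A₀ (1 + 2 Λ₂ + ∑_{j=3}^p Λ_j + A₀)`. -/
def constB' (p : ℕ) (L η : ℝ) (Λ : ℕ → ℝ) : ℝ :=
  constA p L η * (1 + 2 * Λ 2 + ∑ j ∈ Finset.Icc 3 p, Λ j + constA p L η)

/-- `C_R = (p' / 2) (∑_{j=3}^p 2 Λ_j / R)^{p' - 2}`. -/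
def constC (p : ℕ) (R : ℝ) (Λ : ℕ → ℝ) : ℝ :=
  (regOrder p : ℝ) / 2 * (∑ j ∈ Finset.Icc 3 p, 2 * Λ j / R) ^ (regOrder p - 2)

/-- The bounds on `σ = σ_k` in terms of `σ₀`, a constant `B` and `C = C_R`, with `δ = ε^a`:
`σ_k ≤ max {σ₀, γ₁ B ε⁻¹, p' δ / 2, C_R δ^{3 - p'}}` and, for
`C' = max {σ₀, γ₁ B, p' δ / 2, C_R}`,
`σ_k ≤ C' max {ε⁻¹, ε^{a (1 - p)}} = C' ε^{- max {1, a (p - 1)}}`, which is `C' ε⁻¹` for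
`a ≤ 1 / (p - 1)` and `C' ε^{a (1 - p)}` for `a ≥ 1 / (p - 1)`. -/
def SigmaBounds (p : ℕ) (ε a γ₁ σ₀ B C σ : ℝ) : Prop :=
  let δ := ε ^ a
  let C' := max σ₀ (max (γ₁ * B) (max ((regOrder p : ℝ) * δ / 2) C))
  σ ≤ max σ₀ (max (γ₁ * B * ε⁻¹)
      (max ((regOrder p : ℝ) * δ / 2) (C * δ ^ ((3 : ℝ) - (regOrder p : ℝ))))) ∧
  σ ≤ C' * max ε⁻¹ (ε ^ (a * (1 - (p : ℝ)))) ∧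
  σ ≤ C' * ε ^ (-max 1 (a * ((p : ℝ) - 1))) ∧
  (a ≤ 1 / ((p : ℝ) - 1) → σ ≤ C' * ε⁻¹) ∧
  (1 / ((p : ℝ) - 1) ≤ a → σ ≤ C' * ε ^ (a * (1 - (p : ℝ))))

end ARpSoS

end

/-! ### Sums of squares matrices and the radius R. -/

noncomputable section

namespace ARpSoS

open MvPolynomial Matrix

variable {n : ℕ}

/-! Two mechanisms can raise `σ k`: the value of the sum of squares program, and the factor `γ₁`
after an unsuccessful step. `IsRun.sigma_le` combines a bound for each by induction. A failure
multiplies by `γ₁` a value that already obeys the bound for failures, so nothing accumulates, and a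
success never raises the parameter above `max (σ k) σmin`.

The program: the Hessian of `‖s‖² + ‖s‖^p'` contains `2 (1 + ‖s‖^p) I`, which absorbs, in the sum of
squares sense, every monomial matrix of degree at most `p` with small coefficients. This yields R
(`exists_isSoSRadius`). The perturbation makes the quadratic part of the model at least `(δ/2)
‖s‖²`. Hence the model is an affine function, plus a positive semidefinite quadratic form, plus
`(δ/2) ‖s‖²` with the terms of order at least 3 and the regularization. Replacing `s` by `s / r`
brings the last group into the form covered by R, and the choice of `r` gives the two terms in `δ`
(`sosSigma_le_of_scaling`, `sosSigma_le`).

Failures: model decrease against Taylor error gives `σ ‖s‖ ≤ A₀` (`mul_norm_step_le_constA`), so a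
lower bound on `‖s‖` proportional to `ε` suffices. It comes from stationarity of the model at `s`,
compared with the gradient at `x` for `B'` (`le_constB'_mul_inv`) or at `x + s` for `B`
(`le_constB_mul_inv`). -/

theorem isSoSMatrix_transpose_mul_self {ι : Type*} [Fintype ι]
    (V : Matrix ι (Fin n) (MvPolynomial (Fin n) ℝ)) : IsSoSMatrix (Vᵀ * V) := by
  refine ⟨Fintype.card ι, V.submatrix (Fintype.equivFin ι).symm id, ?_⟩
  rw [transpose_submatrix, submatrix_mul_equiv, submatrix_id_id]

theorem isSoSMatrix_zero : IsSoSMatrix (0 : Matrix (Fin n) (Fin n) (MvPolynomial (Fin n) ℝ)) :=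
  ⟨0, 0, by simp⟩

theorem IsSoSMatrix.add {H K : Matrix (Fin n) (Fin n) (MvPolynomial (Fin n) ℝ)}
    (hH : IsSoSMatrix H) (hK : IsSoSMatrix K) : IsSoSMatrix (H + K) := by
  obtain ⟨m, V, rfl⟩ := hH
  obtain ⟨m', W, rfl⟩ := hK
  have := isSoSMatrix_transpose_mul_self (Matrix.fromRows V W)
  rwa [transpose_fromRows, fromCols_mul_fromRows] at this

theorem IsSoSMatrix.sum {ι : Type*} (t : Finset ι)
    {H : ι → Matrix (Fin n) (Fin n) (MvPolynomial (Fin n) ℝ)}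
    (hH : ∀ i ∈ t, IsSoSMatrix (H i)) : IsSoSMatrix (∑ i ∈ t, H i) :=
  Finset.sum_induction H IsSoSMatrix (fun _ _ => IsSoSMatrix.add) isSoSMatrix_zero hH

theorem isSoSMatrix_vecMulVec (w : Fin n → MvPolynomial (Fin n) ℝ) :
    IsSoSMatrix (vecMulVec w w) := by
  have := isSoSMatrix_transpose_mul_self (Matrix.replicateRow Unit w)
  rwa [transpose_replicateRow, ← vecMulVec_eq] at this

theorem IsSoSMatrix.smul {H : Matrix (Fin n) (Fin n) (MvPolynomial (Fin n) ℝ)}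
    (hH : IsSoSMatrix H) {g : MvPolynomial (Fin n) ℝ} (hg : IsSumSq g) : IsSoSMatrix (g • H) := by
  induction hg with
  | zero => rw [zero_smul]; exact isSoSMatrix_zero
  | sq_add a hs ih =>
    rw [add_smul]
    refine IsSoSMatrix.add ?_ ih
    obtain ⟨m, V, rfl⟩ := hH
    have := isSoSMatrix_transpose_mul_self (a • V)
    rwa [transpose_smul, Matrix.smul_mul, Matrix.mul_smul, smul_smul] at this

theorem isSumSq_C {r : ℝ} (hr : 0 ≤ r) : IsSumSq (C r : MvPolynomial (Fin n) ℝ) := by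
  rw [← Real.mul_self_sqrt hr, C_mul]
  exact IsSumSq.mul_self _

theorem IsSoSMatrix.map {H : Matrix (Fin n) (Fin n) (MvPolynomial (Fin n) ℝ)}
    (hH : IsSoSMatrix H) (φ : MvPolynomial (Fin n) ℝ →+* MvPolynomial (Fin n) ℝ) :
    IsSoSMatrix (H.map φ) := by
  obtain ⟨m, V, rfl⟩ := hH
  exact ⟨m, V.map φ, by rw [Matrix.map_mul, transpose_map]⟩

theorem isSoSMatrix_map_C {A : Matrix (Fin n) (Fin n) ℝ} (hA : A.PosSemidef) :
    IsSoSMatrix (A.map (C : ℝ →+* MvPolynomial (Fin n) ℝ)) := by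
  obtain ⟨m, v, rfl⟩ := Matrix.posSemidef_iff_eq_sum_vecMulVec.mp hA
  have : (∑ i, vecMulVec (v i) (star (v i))).map (C : ℝ →+* MvPolynomial (Fin n) ℝ)
      = ∑ i, vecMulVec (fun k => (C (v i k) : MvPolynomial (Fin n) ℝ)) (fun k => C (v i k)) := by
    ext1 k l
    simp [Matrix.sum_apply, vecMulVec_apply]
  rw [this]
  exact IsSoSMatrix.sum _ fun i _ => isSoSMatrix_vecMulVec _

theorem polyHessian_add (P Q : MvPolynomial (Fin n) ℝ) :
    polyHessian (P + Q) = polyHessian P + polyHessian Q := by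
  ext1 i j; simp [polyHessian]

theorem polyHessian_sum {ι : Type*} (t : Finset ι) (P : ι → MvPolynomial (Fin n) ℝ) :
    polyHessian (∑ i ∈ t, P i) = ∑ i ∈ t, polyHessian (P i) := by
  ext1 i j; simp [polyHessian, Matrix.sum_apply]

theorem polyHessian_C_mul (r : ℝ) (P : MvPolynomial (Fin n) ℝ) :
    polyHessian (C r * P) = (C r : MvPolynomial (Fin n) ℝ) • polyHessian P := by
  ext1 i j; simp [polyHessian]

/-- The polynomial `‖s‖²`. -/
def normSqPoly (n : ℕ) : MvPolynomial (Fin n) ℝ := ∑ i, X i ^ 2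

theorem eval_normSqPoly (s : EuclideanSpace ℝ (Fin n)) :
    eval (fun i => s i) (normSqPoly n) = ‖s‖ ^ 2 := by
  simp [normSqPoly, EuclideanSpace.norm_sq_eq]

theorem pderiv_normSqPoly (i : Fin n) : pderiv i (normSqPoly n) = 2 * X i := by
  simp only [normSqPoly, map_sum, Derivation.leibniz_pow, pderiv_X, Pi.single_apply]
  simp

theorem polyHessian_normSqPoly_pow (h : ℕ) :
    polyHessian (normSqPoly n ^ (h + 1)) =
      (2 * (h + 1) * normSqPoly n ^ h : MvPolynomial (Fin n) ℝ) • (1 : Matrix (Fin n) (Fin n) _)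
      + (4 * (h + 1) * h * normSqPoly n ^ (h - 1) : MvPolynomial (Fin n) ℝ) • vecMulVec X X := by
  ext1 i j
  have h2 : (pderiv i (2 : MvPolynomial (Fin n) ℝ)) = 0 := (pderiv i).map_natCast 2
  by_cases hij : i = j
  · subst hij
    simp [polyHessian, Derivation.leibniz_pow, pderiv_normSqPoly, Derivation.leibniz, h2,
      vecMulVec_apply]
    ring_nf
  · have h3 : (Pi.single i 1 : Fin n → MvPolynomial (Fin n) ℝ) j = 0 :=
      Pi.single_eq_of_ne (Ne.symm hij) _
    simp [polyHessian, Derivation.leibniz_pow, pderiv_normSqPoly, Derivation.leibniz, h2, pderiv_X,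
      h3, vecMulVec_apply, Matrix.one_apply_ne hij]
    ring_nf

theorem polyHessian_normSqPoly :
    polyHessian (normSqPoly n) = (2 : MvPolynomial (Fin n) ℝ) • (1 : Matrix (Fin n) (Fin n) _) := by
  simpa using polyHessian_normSqPoly_pow (n := n) 0

theorem isSumSq_normSqPoly : IsSumSq (normSqPoly n) :=
  IsSumSq.sum_sq _ _

theorem _root_.IsSumSq.pow' {R : Type*} [CommSemiring R] {a : R} (ha : IsSumSq a) (k : ℕ) :
    IsSumSq (a ^ k) := by
  induction k with
  | zero => simp
  | succ k ih => rw [pow_succ]; exact ih.mul ha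

/-- With `t = ‖s‖²`, the expression is `(1 - t^k)(1 - t^l) + t^l` for `h = k + l`. Both factors are
divisible by `1 - t`, so the product is `(1 - t)²` times geometric sums in `t`. -/
theorem isSumSq_one_add_pow_sub_pow {k h : ℕ} (hk : k ≤ h) :
    IsSumSq (1 + normSqPoly n ^ h - normSqPoly n ^ k) := by
  obtain ⟨l, rfl⟩ := Nat.exists_eq_add_of_le hk
  have ht := isSumSq_normSqPoly (n := n)
  set t := normSqPoly n
  have e : 1 + t ^ (k + l) - t ^ k = (1 - t) * (1 - t) *
      ((∑ i ∈ Finset.range k, t ^ i) * (∑ i ∈ Finset.range l, t ^ i)) + t ^ l := by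
    have h1 := mul_neg_geom_sum t k
    have h2 := mul_neg_geom_sum t l
    calc 1 + t ^ (k + l) - t ^ k = (1 - t ^ k) * (1 - t ^ l) + t ^ l := by ring
      _ = _ := by rw [← h1, ← h2]; ring
  rw [e]
  exact ((IsSumSq.mul_self _).mul ((IsSumSq.sum fun i _ => ht.pow' i).mul
    (IsSumSq.sum fun i _ => ht.pow' i))).add (ht.pow' l)

/-- The property is multiplicative in the monomial, because `ab - cd = (a - c) b + c (b - d)`. It
therefore reduces to one variable, where `‖s‖² - X i²` is the sum of the other squares. -/
theorem isSumSq_normSqPoly_pow_sub_sq (β : Fin n →₀ ℕ) :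
    IsSumSq (normSqPoly n ^ β.degree - monomial β 1 * monomial β (1 : ℝ)) := by
  induction β using Finsupp.induction_linear with
  | zero => simp
  | add f g hf hg =>
    have e : normSqPoly n ^ (f + g).degree - monomial (f + g) 1 * monomial (f + g) (1 : ℝ) =
        (normSqPoly n ^ f.degree - monomial f 1 * monomial f (1 : ℝ)) * normSqPoly n ^ g.degree +
        (monomial f 1 * monomial f (1 : ℝ)) *
          (normSqPoly n ^ g.degree - monomial g 1 * monomial g (1 : ℝ)) := by
      rw [map_add, pow_add, ← one_mul (1 : ℝ), ← monomial_mul]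
      ring
    rw [e]
    exact (hf.mul (isSumSq_normSqPoly.pow' _)).add ((IsSumSq.mul_self _).mul hg)
  | single i k =>
    induction k with
    | zero => simp
    | succ k ih =>
      rw [Finsupp.degree_single] at ih ⊢
      have h1 : IsSumSq (normSqPoly n - X i * X i) := by
        rw [normSqPoly, ← Finset.add_sum_erase _ _ (Finset.mem_univ i), sq, add_sub_cancel_left]
        exact IsSumSq.sum_sq _ _
      have e : normSqPoly n ^ (k + 1) - monomial (Finsupp.single i (k + 1)) 1 *
          monomial (Finsupp.single i (k + 1)) (1 : ℝ) =
          (normSqPoly n ^ k - monomial (Finsupp.single i k) 1 * monomial (Finsupp.single i k) 1)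
            * normSqPoly n + (monomial (Finsupp.single i k) 1 * monomial (Finsupp.single i k) 1) *
            (normSqPoly n - X i * X i) := by
        rw [Finsupp.single_add, ← one_mul (1 : ℝ), ← monomial_mul]
        simp only [X]
        ring
      rw [e]
      exact (ih.mul isSumSq_normSqPoly).add ((IsSumSq.mul_self _).mul h1)

theorem isSumSq_one_add_pow_sub_sq {β : Fin n →₀ ℕ} {h : ℕ} (hβ : β.degree ≤ h) :
    IsSumSq (1 + normSqPoly n ^ h - monomial β 1 * monomial β (1 : ℝ)) := by
  have := (isSumSq_one_add_pow_sub_pow (n := n) hβ).add (isSumSq_normSqPoly_pow_sub_sq β)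
  rwa [sub_add_sub_cancel] at this

/-- The matrix unit with `1` at position `(i, j)`. -/
abbrev polyUnit (i j : Fin n) : Matrix (Fin n) (Fin n) (MvPolynomial (Fin n) ℝ) :=
  vecMulVec (Pi.single i 1) (Pi.single j 1)

theorem exists_add_eq_degree_le (α : Fin n →₀ ℕ) {h : ℕ} (hα : α.degree ≤ 2 * h) :
    ∃ β γ, β + γ = α ∧ β.degree ≤ h ∧ γ.degree ≤ h := by
  obtain ⟨β, hβ, hd⟩ := Finsupp.exists_le_degree_eq α (min h α.degree) (min_le_right _ _)
  obtain ⟨γ, rfl⟩ := exists_add_of_le hβ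
  refine ⟨β, γ, rfl, hd ▸ min_le_left _ _, ?_⟩
  rw [map_add] at hd hα
  omega

/-- Split the monomial as `s^β s^γ` with both degrees at most `h`. The cross terms of the square of
`s^β e_i ± s^γ e_j`, with the sign of `a`, are the off-diagonal part. Its diagonal entries `s^(2β)`
and `s^(2γ)` are each dominated by `1 + ‖s‖^(2h)`. -/
theorem isSoSMatrix_monomial_offDiag (i j : Fin n) {α : Fin n →₀ ℕ} {h : ℕ}
    (hα : α.degree ≤ 2 * h) (a : ℝ) :
    IsSoSMatrix (monomial α a • (polyUnit i j + polyUnit j i)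
      + (C |a| * (1 + normSqPoly n ^ h)) • (polyUnit i i + polyUnit j j)) := by
  obtain ⟨β, γ, rfl, hβ, hγ⟩ := exists_add_eq_degree_le α hα
  obtain ⟨e, he, ha⟩ : ∃ e : ℝ, e * e = 1 ∧ |a| * e = a := by
    rcases abs_cases a with ⟨h1, -⟩ | ⟨h1, -⟩
    · exact ⟨1, by simp, by simp [h1]⟩
    · exact ⟨-1, by simp, by simp [h1]⟩
  have he' : (C e * C e : MvPolynomial (Fin n) ℝ) = 1 := by rw [← C_mul, he, C_1]
  have hm : monomial (β + γ) a =
      (C |a| * C e) * (monomial β 1 * monomial γ 1 : MvPolynomial (Fin n) ℝ) := by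
    rw [monomial_mul, ← C_mul, ha, C_mul_monomial, mul_one, mul_one]
  have h1 := isSumSq_one_add_pow_sub_sq hβ
  have h2 := isSumSq_one_add_pow_sub_sq hγ
  rw [hm]
  set b : MvPolynomial (Fin n) ℝ := monomial β 1
  set g : MvPolynomial (Fin n) ℝ := monomial γ 1
  have key := ((isSoSMatrix_vecMulVec (b • Pi.single i 1 + (C e * g) • Pi.single j 1)).add
    (((isSoSMatrix_vecMulVec (Pi.single i 1)).smul h1).add
      ((isSoSMatrix_vecMulVec (Pi.single j 1)).smul h2))).smul (isSumSq_C (n := n) (abs_nonneg a))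
  convert key using 1
  simp only [vecMulVec_add, add_vecMulVec, vecMulVec_smul, smul_vecMulVec, polyUnit]
  linear_combination (norm := module) (-(C |a| * g * g) * he') •
    (vecMulVec (Pi.single j 1) (Pi.single j 1) : Matrix (Fin n) (Fin n) (MvPolynomial (Fin n) ℝ))

theorem sum_smul_polyUnit (M : Matrix (Fin n) (Fin n) (MvPolynomial (Fin n) ℝ)) :
    ∑ i, ∑ j, M i j • (polyUnit i j + polyUnit j i) = M + Mᵀ := by
  ext1 k l
  simp [Matrix.sum_apply, vecMulVec_apply, Pi.single_apply, Finset.sum_add_distrib]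

theorem sum_polyUnit_diag :
    ∑ i : Fin n, ∑ j : Fin n, (polyUnit i i + polyUnit j j) =
      (2 * n : MvPolynomial (Fin n) ℝ) • (1 : Matrix (Fin n) (Fin n) _) := by
  have h1 : ∑ i : Fin n, polyUnit i i = (1 : Matrix (Fin n) (Fin n) (MvPolynomial (Fin n) ℝ)) := by
    ext1 k l
    simp [Matrix.sum_apply, vecMulVec_apply, Pi.single_apply, Matrix.one_apply]
  simp only [Finset.sum_add_distrib, Finset.sum_const, Finset.card_univ, Fintype.card_fin,
    ← Finset.smul_sum, h1, ← Nat.cast_smul_eq_nsmul (MvPolynomial (Fin n) ℝ)]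
  module

theorem isSoSMatrix_polyHessian_monomial_add {m : Fin n →₀ ℕ} {h : ℕ} (hm : m.degree ≤ 2 * h)
    (a : ℝ) :
    IsSoSMatrix (polyHessian (monomial m a) +
      (C (n * (|a| * (2 * h) ^ 2)) * (1 + normSqPoly n ^ h)) •
        (1 : Matrix (Fin n) (Fin n) (MvPolynomial (Fin n) ℝ))) := by
  set M := polyHessian (monomial m a)
  set D : MvPolynomial (Fin n) ℝ := 1 + normSqPoly n ^ h
  set B : ℝ := |a| * (2 * h) ^ 2
  have hD : IsSumSq D := IsSumSq.one.add (isSumSq_normSqPoly.pow' h)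
  have hsymm : Mᵀ = M := by
    ext1 i j
    simp only [M, polyHessian, transpose_apply, of_apply, pderiv_monomial]
    by_cases hij : i = j
    · rw [hij]
    · rw [tsub_right_comm]
      congr 1
      simp [hij, Ne.symm hij]
      ring
  have hle : ∀ i, (m i : ℝ) ≤ 2 * h := fun i => by
    exact_mod_cast (Finsupp.le_degree i m).trans hm
  have term : ∀ i j : Fin n, IsSoSMatrix (M i j • (polyUnit i j + polyUnit j i) +
      (C B * D) • (polyUnit i i + polyUnit j j)) := by
    intro i j
    have hMij : M i j = monomial (m - Finsupp.single j 1 - Finsupp.single i 1)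
        (a * m j * ((m - Finsupp.single j 1 : Fin n →₀ ℕ) i)) := by
      simp only [M, polyHessian, of_apply, pderiv_monomial]
    set r : ℝ := a * m j * ((m - Finsupp.single j 1 : Fin n →₀ ℕ) i)
    have hr : |r| ≤ B := by
      have h1 : (((m - Finsupp.single j 1 : Fin n →₀ ℕ) i : ℕ) : ℝ) ≤ 2 * h :=
        le_trans (by exact_mod_cast (tsub_le_self : m - Finsupp.single j 1 ≤ m) i) (hle i)
      rw [abs_mul, abs_mul, Nat.abs_cast, Nat.abs_cast, mul_assoc]
      exact mul_le_mul_of_nonneg_left ((mul_le_mul (hle j) h1 (by positivity)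
        (by positivity)).trans_eq (sq _).symm) (abs_nonneg a)
    have hdeg : (m - Finsupp.single j 1 - Finsupp.single i 1).degree ≤ 2 * h :=
      (Finsupp.degree_mono (tsub_le_self.trans tsub_le_self)).trans hm
    have k1 := isSoSMatrix_monomial_offDiag i j hdeg r
    have k2 := ((isSoSMatrix_vecMulVec (Pi.single i 1)).add
      (isSoSMatrix_vecMulVec (Pi.single j 1))).smul
        ((isSumSq_C (n := n) (sub_nonneg.mpr hr)).mul hD)
    rw [hMij]
    convert k1.add k2 using 1
    rw [C_sub]
    module
  -- Summing over all pairs produces `M + Mᵀ = 2 M` and `2n` copies of the identity; the factor `1 /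
  -- 2` undoes both.
  have hsum := (IsSoSMatrix.sum Finset.univ fun i _ =>
    IsSoSMatrix.sum Finset.univ fun j _ => term i j).smul
      (isSumSq_C (n := n) (by norm_num : (0 : ℝ) ≤ 1 / 2))
  convert hsum using 1
  have e : ∑ i, ∑ j, (M i j • (polyUnit i j + polyUnit j i) +
      (C B * D) • (polyUnit i i + polyUnit j j)) = M + M +
      (C B * D) • (2 * n : MvPolynomial (Fin n) ℝ) • (1 : Matrix (Fin n) (Fin n) _) := by
    rw [← sum_polyUnit_diag]
    have hMM : M + M = M + Mᵀ := by rw [hsymm]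
    rw [hMM, ← sum_smul_polyUnit M]
    simp only [Finset.smul_sum, ← Finset.sum_add_distrib]
  rw [e, ← two_smul (MvPolynomial (Fin n) ℝ) M]
  have h12 : (C (1 / 2) * 2 : MvPolynomial (Fin n) ℝ) = 1 := by
    rw [show (2 : MvPolynomial (Fin n) ℝ) = C 2 from rfl, ← C_mul]; norm_num
  simp only [smul_add, smul_smul, h12, one_smul]
  congr 2
  rw [C_mul, show (C (n : ℝ) : MvPolynomial (Fin n) ℝ) = n from map_natCast _ _]
  linear_combination (-C B * D * n) * h12

theorem isSoSMatrix_polyHessian_normSqPoly_add {h : ℕ} {R : ℝ} (S : Finset (Fin n →₀ ℕ))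
    (hS : ∀ m : Fin n →₀ ℕ, m.degree ≤ 2 * h → m ∈ S)
    (hR : n * (R * S.card * (2 * h) ^ 2) ≤ 2) {q : MvPolynomial (Fin n) ℝ}
    (hq : q.totalDegree ≤ 2 * h) (hqR : ∀ m, |q.coeff m| ≤ R) :
    IsSoSMatrix (polyHessian (normSqPoly n + normSqPoly n ^ (h + 1) + q)) := by
  have hdeg : ∀ m ∈ q.support, m.degree ≤ 2 * h := fun m hm => (le_totalDegree hm).trans hq
  have hR0 : 0 ≤ R := (abs_nonneg _).trans (hqR 0)
  have hD : IsSumSq (1 + normSqPoly n ^ h) := IsSumSq.one.add (isSumSq_normSqPoly.pow' h)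
  have hI : IsSoSMatrix (1 : Matrix (Fin n) (Fin n) (MvPolynomial (Fin n) ℝ)) := by
    simpa using isSoSMatrix_transpose_mul_self (1 : Matrix (Fin n) (Fin n) _)
  set D := 1 + normSqPoly n ^ h
  set B : ℝ := ∑ m ∈ q.support, n * (|q.coeff m| * (2 * h) ^ 2) with hB
  have hB2 : 0 ≤ 2 - B := by
    rw [sub_nonneg]
    refine le_trans ?_ hR
    calc B ≤ ∑ m ∈ S, n * (R * (2 * h) ^ 2) := by
          refine (Finset.sum_le_sum fun m _ => ?_).trans (Finset.sum_le_sum_of_subset_of_nonneg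
            (fun m hm => hS m (hdeg m hm)) fun _ _ _ => by positivity)
          gcongr
          exact hqR m
      _ = n * (R * S.card * (2 * h) ^ 2) := by
          rw [Finset.sum_const, nsmul_eq_mul]; ring
  have h1 : IsSoSMatrix (polyHessian q + (C B * D) • 1) := by
    have := IsSoSMatrix.sum q.support fun m hm =>
      isSoSMatrix_polyHessian_monomial_add (hdeg m hm) (q.coeff m)
    rw [Finset.sum_add_distrib, ← polyHessian_sum, ← q.as_sum, ← Finset.sum_smul,
      ← Finset.sum_mul, ← map_sum, ← hB] at this
    exact this
  have h2 : IsSumSq (C (2 * h : ℝ) * normSqPoly n ^ h) :=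
    (isSumSq_C (by positivity)).mul (isSumSq_normSqPoly.pow' h)
  have h3 : IsSumSq (C (4 * (h + 1) * h : ℝ) * normSqPoly n ^ (h - 1)) :=
    (isSumSq_C (by positivity)).mul (isSumSq_normSqPoly.pow' _)
  -- The coefficient `2 + 2 (h + 1) t^h` of the identity, `t = ‖s‖²`, is `B D + (2 - B) D + 2 h
  -- t^h`: the first piece absorbs the Hessian of `q`, the others are sums of squares.
  have key := (h1.add (hI.smul ((isSumSq_C hB2).mul hD))).add
    ((hI.smul h2).add ((isSoSMatrix_vecMulVec X).smul h3))
  convert key using 1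
  rw [polyHessian_add, polyHessian_add, polyHessian_normSqPoly, polyHessian_normSqPoly_pow]
  have c2 : (C 2 : MvPolynomial (Fin n) ℝ) = 2 := rfl
  have c4 : (C 4 : MvPolynomial (Fin n) ℝ) = 4 := rfl
  have ch : (C (h : ℝ) : MvPolynomial (Fin n) ℝ) = h := map_natCast _ _
  simp only [C_sub, C_mul, C_add, C_1, c2, c4, ch, D]
  module

theorem regOrder_of_even {p : ℕ} (hp : Even p) : regOrder p = p + 2 := by
  simp [regOrder, hp]

theorem exists_isSoSRadius (n : ℕ) {p : ℕ} (hp : Even p) : ∃ R : ℝ, IsSoSRadius n p R := by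
  obtain ⟨h, rfl⟩ := hp
  have hfin := Finsupp.finite_of_degree_le (σ := Fin n) (2 * h)
  set S := hfin.toFinset
  set K : ℝ := n * (S.card * (2 * h) ^ 2)
  have hK : 0 ≤ K := by positivity
  -- This value makes the total absorbed weight `K / (K + 1)`, below the available 2; adding 1 to
  -- `K` covers `K = 0`.
  refine ⟨1 / (K + 1), by positivity, fun q hq hqR => ?_⟩
  rw [← two_mul] at hq
  refine ⟨normSqPoly n + normSqPoly n ^ (h + 1) + q, fun s => ?_,
    isSoSMatrix_polyHessian_normSqPoly_add S (fun m hm => hfin.mem_toFinset.mpr hm) ?_ hq hqR⟩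
  · rw [map_add, map_add, map_pow, eval_normSqPoly, regOrder_of_even ⟨h, rfl⟩, ← pow_mul]
    congr 3
    ring
  · have : n * (1 / (K + 1) * S.card * (2 * h) ^ 2) = K / (K + 1) := by
      simp only [K]; ring
    rw [this, div_le_iff₀ (by positivity)]
    linarith

end ARpSoS
end

/-! ### Taylor estimates and stationarity of the model. -/

noncomputable section

namespace ARpSoS

universe u

theorem iteratedFDeriv_fderiv_fderiv_swap {E F : Type u} [NormedAddCommGroup E] [NormedSpace ℝ E]
    [NormedAddCommGroup F] [NormedSpace ℝ F] {f : E → F} {j : ℕ}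
    (hf : ContDiff ℝ ((j + 1 + 1 : ℕ) : ℕ∞) f) (x : E) (m : Fin j → E) (v w : E) :
    iteratedFDeriv ℝ j (fderiv ℝ (fderiv ℝ f)) x m v w =
      iteratedFDeriv ℝ j (fderiv ℝ (fderiv ℝ f)) x m w v := by
  have h1 : ContDiff ℝ ((j + 1 : ℕ) : ℕ∞) (fderiv ℝ f) :=
    hf.fderiv_right (by norm_cast)
  have hg : ContDiff ℝ (j : ℕ∞) (fderiv ℝ (fderiv ℝ f)) := h1.fderiv_right (by norm_cast)
  have apply_eq : ∀ a b : E, iteratedFDeriv ℝ j (fderiv ℝ (fderiv ℝ f)) x m a b =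
      iteratedFDeriv ℝ j (fun y => fderiv ℝ (fderiv ℝ f) y a b) x m := fun a b => by
    rw [iteratedFDeriv_clm_apply_const_apply (hg.clm_apply contDiff_const) le_rfl,
      iteratedFDeriv_clm_apply_const_apply hg le_rfl]
  rw [apply_eq, apply_eq]
  congr 2
  ext y
  have h2 : ContDiff ℝ ((2 : ℕ) : ℕ∞) f := hf.of_le (by exact_mod_cast Nat.le_add_left 2 j)
  have : IsSymmSndFDerivAt ℝ f y := h2.contDiffAt.isSymmSndFDerivAt (by
    rw [minSmoothness_of_isRCLikeNormedField]; rfl)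
  exact this v w

/-- Symmetry of the derivative in the form needed to differentiate `s ↦ D^j f(x)[s, …, s]`. The last
slot holds by definition; any other slot follows by induction applied to `fderiv ℝ f`, exchanging
the last two arguments by symmetry of second derivatives. The induction replaces `F` by `E →L[ℝ] F`,
hence the common universe. -/
theorem iteratedFDeriv_update_const {E F : Type u} [NormedAddCommGroup E] [NormedSpace ℝ E]
    [NormedAddCommGroup F] [NormedSpace ℝ F] {f : E → F} {j : ℕ}
    (hf : ContDiff ℝ ((j + 1 : ℕ) : ℕ∞) f) (x s v : E) (i : Fin (j + 1)) :
    iteratedFDeriv ℝ (j + 1) f x (Function.update (fun _ => s) i v) =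
      iteratedFDeriv ℝ j (fderiv ℝ f) x (fun _ => s) v := by
  induction j generalizing F with
  | zero =>
    rw [Fin.fin_one_eq_zero i, iteratedFDeriv_succ_apply_right]
    simp
  | succ j ih =>
    rw [iteratedFDeriv_succ_apply_right]
    induction i using Fin.lastCases with
    | last =>
      rw [Function.update_self, Fin.init_update_last]
      rfl
    | cast i =>
      rw [Function.update_of_ne (Fin.castSucc_lt_last i).ne', Fin.init_update_castSucc]
      have h1 : ContDiff ℝ ((j + 1 : ℕ) : ℕ∞) (fderiv ℝ f) := hf.fderiv_right (by norm_cast)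
      have h2 := ih h1 i
      have h3 : iteratedFDeriv ℝ (j + 1) (fderiv ℝ f) x (fun _ => s) =
          iteratedFDeriv ℝ j (fderiv ℝ (fderiv ℝ f)) x (fun _ => s) s :=
        iteratedFDeriv_succ_apply_right _
      have h4 := congrArg (fun T => T s) h2
      rw [h3, iteratedFDeriv_fderiv_fderiv_swap hf]
      exact h4

theorem hasFDerivAt_iteratedFDeriv_diag {E F : Type u} [NormedAddCommGroup E] [NormedSpace ℝ E]
    [NormedAddCommGroup F] [NormedSpace ℝ F] {f : E → F} {j : ℕ}
    (hf : ContDiff ℝ ((j + 1 : ℕ) : ℕ∞) f) (x s : E) :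
    HasFDerivAt (fun s => iteratedFDeriv ℝ (j + 1) f x (fun _ => s))
      (((j + 1 : ℕ) : ℝ) • iteratedFDeriv ℝ j (fderiv ℝ f) x (fun _ => s)) s := by
  have h := ((iteratedFDeriv ℝ (j + 1) f x).hasFDerivAt (x := fun _ => s)).comp s
    (f := fun (s : E) (_ : Fin (j + 1)) => s) (hasFDerivAt_pi.2 fun _ : Fin (j + 1) => hasFDerivAt_id s)
  convert! h using 1
  ext v
  simp [iteratedFDeriv_update_const hf, ← Nat.cast_smul_eq_nsmul ℝ]

/-- The derivative of the remainder of order `p + 1` is the remainder of order `p` of the shifted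
family, so the mean value inequality gives the induction. Only a Lipschitz bound at the base point
is used for the top derivative, which need not be differentiable. -/
theorem norm_taylor_remainder_le {F : Type*} [NormedAddCommGroup F] [NormedSpace ℝ F]
    {p : ℕ} {h : ℕ → ℝ → F} {K : ℝ}
    (hd : ∀ j < p, ∀ t, HasDerivAt (h j) (h (j + 1) t) t)
    (hp : ∀ t, 0 ≤ t → ‖h p t - h p 0‖ ≤ K * t) {t : ℝ} (ht : 0 ≤ t) :
    ‖h 0 t - ∑ j ∈ Finset.range (p + 1), (t ^ j / j.factorial : ℝ) • h j 0‖ ≤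
      K * (t ^ (p + 1) / (p + 1).factorial) := by
  induction p generalizing h t with
  | zero => simpa using hp t ht
  | succ p ih =>
    have ih' := fun {t} => ih (h := fun j => h (j + 1)) (t := t)
      (fun j hj => hd (j + 1) (by omega)) hp
    have hpow : ∀ (j : ℕ) (y : ℝ), HasDerivAt (fun t : ℝ => t ^ (j + 1) / (j + 1).factorial)
        (y ^ j / j.factorial) y := by
      intro j y
      convert! (hasDerivAt_pow (j + 1) y).div_const ((j + 1).factorial : ℝ) using 1
      rw [Nat.factorial_succ]
      push_cast
      field_simp
    have hder : ∀ y, HasDerivAt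
        (fun t => h 0 t - ∑ j ∈ Finset.range (p + 1 + 1), (t ^ j / j.factorial : ℝ) • h j 0)
        (h 1 y - ∑ j ∈ Finset.range (p + 1), (y ^ j / j.factorial : ℝ) • h (j + 1) 0) y := by
      intro y
      refine (hd 0 (by omega) y).sub ?_
      simp only [Finset.sum_range_succ' _ (p + 1)]
      have := (HasDerivAt.fun_sum fun j (_ : j ∈ Finset.range (p + 1)) =>
        (hpow j y).smul_const (h (j + 1) 0)).add_const ((1 : ℝ) • h 0 0)
      simpa using this
    refine image_norm_le_of_norm_deriv_right_le_deriv_boundary (a := 0) (b := t)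
      (f := fun t => h 0 t - ∑ j ∈ Finset.range (p + 1 + 1), (t ^ j / j.factorial : ℝ) • h j 0)
      (B := fun t => K * (t ^ (p + 1 + 1) / (p + 1 + 1).factorial))
      (fun y _ => (hder y).continuousAt.continuousWithinAt)
      (fun y _ => (hder y).hasDerivWithinAt) ?_ (fun y => (hpow (p + 1) y).const_mul K)
      (fun y hy => ih' hy.1) ⟨ht, le_rfl⟩
    simp [Finset.sum_range_succ']

/-- Restriction to the segment `t ↦ x + t s`. The target is a general normed space so that the
estimate serves both `f` and its derivative. -/
theorem norm_sub_taylor_le {E F : Type*} [NormedAddCommGroup E] [NormedSpace ℝ E]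
    [NormedAddCommGroup F] [NormedSpace ℝ F] {f : E → F} {p : ℕ} {K : ℝ}
    (hf : ContDiff ℝ (p : ℕ∞) f)
    (hL : ∀ y z, ‖iteratedFDeriv ℝ p f y - iteratedFDeriv ℝ p f z‖ ≤ K * ‖y - z‖) (x s : E) :
    ‖f (x + s) - ∑ j ∈ Finset.range (p + 1),
        (1 / (j.factorial : ℝ)) • iteratedFDeriv ℝ j f x (fun _ => s)‖ ≤
      K / (p + 1).factorial * ‖s‖ ^ (p + 1) := by
  have key := norm_taylor_remainder_le (p := p) (K := K * ‖s‖ ^ (p + 1))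
    (h := fun j t => iteratedFDeriv ℝ j f (x + t • s) (fun _ => s)) ?_ ?_ zero_le_one
  · simpa [div_eq_mul_inv, mul_assoc, mul_comm, mul_left_comm] using key
  · intro j hj t
    have hc : ContDiffAt ℝ ((j : ℕ∞) + 1) f (x + t • s) :=
      hf.contDiffAt.of_le (by exact_mod_cast hj)
    have h1 := ContDiffAt.deriv_fderiv_add_smul (n := j) (t := t) (y := s) (x := x) hc
    have hd : DifferentiableAt ℝ (iteratedFDeriv ℝ j f) (x + t • s) :=
      hf.contDiffAt.differentiableAt_iteratedFDeriv (by exact_mod_cast hj)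
    rw [← h1]
    refine DifferentiableAt.hasDerivAt ?_
    fun_prop
  · intro t ht
    simp only [zero_smul, add_zero]
    rw [← sub_apply]
    refine (ContinuousMultilinearMap.le_opNorm _ _).trans ?_
    have := hL (x + t • s) x
    rw [add_sub_cancel_left, norm_smul, Real.norm_of_nonneg ht] at this
    simp only [Finset.prod_const, Finset.card_univ, Fintype.card_fin]
    calc _ ≤ K * (t * ‖s‖) * ‖s‖ ^ p := by gcongr
      _ = _ := by ring

theorem sum_Icc_one_eq_sum_range {M : Type*} [AddCommMonoid M] (g : ℕ → M) (p : ℕ) :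
    ∑ j ∈ Finset.Icc 1 p, g j = ∑ j ∈ Finset.range p, g (j + 1) := by
  rw [Finset.range_eq_Ico, Finset.sum_Ico_add' g 0 p 1]
  rfl

variable {n p : ℕ} {f : EuclideanSpace ℝ (Fin n) → ℝ} {L : ℝ}

theorem abs_sub_taylorModel_le (hp : 1 ≤ p) (hL0 : 0 ≤ L) (hf : ContDiff ℝ (p : ℕ∞) f)
    (hL : ∀ y z, ‖iteratedFDeriv ℝ p f y - iteratedFDeriv ℝ p f z‖ ≤
      ((p - 1).factorial : ℝ) * L * ‖y - z‖) (x s : EuclideanSpace ℝ (Fin n)) :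
    |f (x + s) - taylorModel f p x s| ≤ L / (p + 1) * ‖s‖ ^ (p + 1) := by
  have h := norm_sub_taylor_le hf hL x s
  obtain ⟨q, rfl⟩ := Nat.exists_eq_add_of_le' hp
  rw [Finset.sum_range_succ'] at h
  simp only [taylorModel, sum_Icc_one_eq_sum_range]
  rw [← Real.norm_eq_abs]
  refine le_trans (le_of_eq_of_le ?_ h) ?_
  · congr 2
    simp [add_comm]
  · refine mul_le_mul_of_nonneg_right ?_ (by positivity)
    rw [Nat.factorial_succ, Nat.factorial_succ, Nat.add_sub_cancel]
    push_cast
    -- The remainder constant is `L / (p (p + 1))`; the factor `1 / p` is given away.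
    have : ((q.factorial : ℝ) * L) / ((q + 1 + 1) * ((q + 1) * q.factorial)) =
        L / (q + 1 + 1) / (q + 1) := by field_simp
    rw [this]
    exact div_le_self (by positivity) (by linarith [(Nat.cast_nonneg q : (0 : ℝ) ≤ q)])

/-- The derivative of `s ↦ T_p(x, s)`. -/
def taylorModelFDeriv (f : EuclideanSpace ℝ (Fin n) → ℝ) (p : ℕ)
    (x s : EuclideanSpace ℝ (Fin n)) : EuclideanSpace ℝ (Fin n) →L[ℝ] ℝ :=
  ∑ j ∈ Finset.range p, (1 / (j.factorial : ℝ)) • iteratedFDeriv ℝ j (fderiv ℝ f) x (fun _ => s)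

theorem hasFDerivAt_taylorModel (hf : ContDiff ℝ (p : ℕ∞) f) (x s : EuclideanSpace ℝ (Fin n)) :
    HasFDerivAt (taylorModel f p x) (taylorModelFDeriv f p x s) s := by
  unfold taylorModel taylorModelFDeriv
  simp only [sum_Icc_one_eq_sum_range]
  refine HasFDerivAt.const_add _ (HasFDerivAt.fun_sum fun j hj => ?_)
  have hj' : j + 1 ≤ p := Finset.mem_range.mp hj
  have h := (hasFDerivAt_iteratedFDeriv_diag (hf.of_le (by exact_mod_cast hj')) x s).const_mul
    (1 / ((j + 1).factorial : ℝ))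
  convert! h using 1
  rw [smul_smul, Nat.factorial_succ]
  congr 1
  push_cast
  field_simp

theorem norm_fderiv_sub_taylorModelFDeriv_le (hp : 1 ≤ p) (hL0 : 0 ≤ L)
    (hf : ContDiff ℝ (p : ℕ∞) f)
    (hL : ∀ y z, ‖iteratedFDeriv ℝ p f y - iteratedFDeriv ℝ p f z‖ ≤
      ((p - 1).factorial : ℝ) * L * ‖y - z‖) (x s : EuclideanSpace ℝ (Fin n)) :
    ‖fderiv ℝ f (x + s) - taylorModelFDeriv f p x s‖ ≤ L * ‖s‖ ^ p := by
  obtain ⟨q, rfl⟩ := Nat.exists_eq_add_of_le' hp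
  have hf' : ContDiff ℝ (q : ℕ∞) (fderiv ℝ f) := hf.fderiv_right (by norm_cast)
  have h := norm_sub_taylor_le hf' (K := ((q + 1 - 1).factorial : ℝ) * L) (fun y z => by
    refine le_of_eq_of_le ?_ (hL y z)
    rw [iteratedFDeriv_succ_eq_comp_right, iteratedFDeriv_succ_eq_comp_right]
    simp only [Function.comp_apply]
    rw [← dist_eq_norm, ← dist_eq_norm, LinearIsometryEquiv.dist_map]) x s
  refine h.trans (mul_le_mul_of_nonneg_right ?_ (by positivity))
  rw [Nat.add_sub_cancel, Nat.factorial_succ]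
  push_cast
  have : ((q.factorial : ℝ) * L) / ((q + 1) * q.factorial) = L / (q + 1) := by field_simp
  rw [this]
  exact div_le_self hL0 (by linarith [(Nat.cast_nonneg q : (0 : ℝ) ≤ q)])

theorem hasFDerivAt_norm_pow_even {E : Type*} [NormedAddCommGroup E] [InnerProductSpace ℝ E]
    (h : ℕ) (s : E) :
    HasFDerivAt (fun s : E => ‖s‖ ^ (2 * (h + 1)))
      ((2 * (h + 1) * ‖s‖ ^ (2 * h) : ℝ) • innerSL ℝ s) s := by
  have h1 := (hasStrictFDerivAt_norm_sq s).hasFDerivAt.pow (h + 1)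
  simp only [← pow_mul] at h1
  convert! h1 using 1
  ext v
  simp
  ring

/-- First order optimality of a global minimizer of the SoS Taylor model. -/
theorem taylorModelFDeriv_add_eq_zero (hpe : Even p) (hf : ContDiff ℝ (p : ℕ∞) f)
    {x s : EuclideanSpace ℝ (Fin n)} {c σ : ℝ}
    (hs : ∀ v, sosTaylorModel f p x c σ s ≤ sosTaylorModel f p x c σ v) :
    taylorModelFDeriv f p x s +
      (c + σ * ‖s‖ ^ p) • innerSL (E := EuclideanSpace ℝ (Fin n)) ℝ s = 0 := by
  have h1 := hasFDerivAt_taylorModel hf x s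
  have h2 := (hasFDerivAt_norm_pow_even (E := EuclideanSpace ℝ (Fin n)) 0 s).const_mul (c / 2)
  obtain ⟨h, rfl⟩ := hpe
  have h3 := (hasFDerivAt_norm_pow_even (E := EuclideanSpace ℝ (Fin n)) h s).const_mul
    (σ / (regOrder (h + h) : ℝ))
  have hr : regOrder (h + h) = 2 * (h + 1) := by simp [regOrder]; ring
  have h4 := (h1.add h2).add h3
  have h5 := IsLocalMin.hasFDerivAt_eq_zero (Filter.Eventually.of_forall fun v => by
    simpa only [sosTaylorModel, hr, Pi.add_apply, zero_add, mul_one] using hs v) h4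
  rw [← h5, hr]
  push_cast
  rw [add_assoc, smul_smul, smul_smul, ← add_smul]
  congr 2
  have : (2 * (h + 1) : ℝ) ≠ 0 := by positivity
  field_simp
  ring

end ARpSoS
end

/-! ### Scaling of variables and polynomials of multilinear forms. -/

noncomputable section

namespace ARpSoS

open MvPolynomial Matrix

variable {n : ℕ}

theorem pderiv_bind₁_C_mul_X (t : ℝ) (P : MvPolynomial (Fin n) ℝ) (i : Fin n) :
    pderiv i (bind₁ (fun k => C t * X k : Fin n → MvPolynomial (Fin n) ℝ) P) =
      C t * bind₁ (fun k => C t * X k : Fin n → MvPolynomial (Fin n) ℝ) (pderiv i P) := by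
  induction P using MvPolynomial.induction_on with
  | C a => simp
  | add P Q hP hQ => simp only [map_add, hP, hQ, mul_add]
  | mul_X P k hP =>
    have h1 : bind₁ (fun k => C t * X k : Fin n → MvPolynomial (Fin n) ℝ)
        (pderiv i (X k : MvPolynomial (Fin n) ℝ)) = pderiv i (X k) := by
      rw [pderiv_X, Pi.single_apply]
      split_ifs <;> simp
    simp only [map_mul, pderiv_mul, hP, map_add, bind₁_X_right, pderiv_C, h1]
    ring

/-- By the chain rule the Hessian of `P(t s)` is `t²` times the Hessian of `P` evaluated at `t s`,
and substitution is a ring homomorphism. -/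
theorem IsSoSMatrix.polyHessian_bind₁ {P : MvPolynomial (Fin n) ℝ}
    (hP : IsSoSMatrix (polyHessian P)) (t : ℝ) :
    IsSoSMatrix (polyHessian (bind₁ (fun k => C t * X k : Fin n → MvPolynomial (Fin n) ℝ) P)) := by
  have h := (hP.map (bind₁ (fun k => C t * X k : Fin n → MvPolynomial (Fin n) ℝ)).toRingHom).smul
    (IsSumSq.mul_self (C t : MvPolynomial (Fin n) ℝ))
  convert h using 1
  ext1 i j
  simp [polyHessian, pderiv_bind₁_C_mul_X, mul_assoc]

/-- The quadratic form `∑ᵢⱼ Aᵢⱼ sᵢ sⱼ`. -/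
def quadPoly (A : Matrix (Fin n) (Fin n) ℝ) : MvPolynomial (Fin n) ℝ :=
  ∑ i, ∑ j, C (A i j) * (X i * X j)

theorem polyHessian_quadPoly (A : Matrix (Fin n) (Fin n) ℝ) :
    polyHessian (quadPoly A) = (A + Aᵀ).map (C : ℝ →+* MvPolynomial (Fin n) ℝ) := by
  ext1 k l
  have h1 : ∀ a b : Fin n, pderiv a (Pi.single (M := fun _ => MvPolynomial (Fin n) ℝ) b 1 l) = 0 := by
    intro a b
    rw [Pi.single_apply]
    split_ifs <;> simp
  simp only [polyHessian, quadPoly, of_apply, map_sum, pderiv_mul, pderiv_X, map_add]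
  simp [Pi.single_apply, Finset.sum_add_distrib, apply_ite (pderiv k), mul_add, add_comm]

theorem polyHessian_linear (b : Fin n → ℝ) (a : ℝ) :
    polyHessian (C a + ∑ i, C (b i) * X i) = 0 := by
  ext1 k l
  simp only [polyHessian, of_apply, map_sum, pderiv_C_mul, pderiv_X, map_add, pderiv_C]
  simp [Pi.single_apply, apply_ite (pderiv k)]

theorem euclidean_sum_single (s : EuclideanSpace ℝ (Fin n)) :
    ∑ i, s i • EuclideanSpace.single i (1 : ℝ) = s := by
  ext k
  simp [Finset.sum_apply, Pi.single_apply]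

/-- The polynomial `s ↦ M[s, …, s]` of a multilinear form `M`. -/
def diagPoly {j : ℕ} (M : ContinuousMultilinearMap ℝ (fun _ : Fin j => EuclideanSpace ℝ (Fin n)) ℝ) :
    MvPolynomial (Fin n) ℝ :=
  ∑ φ : Fin j → Fin n, monomial (∑ k, Finsupp.single (φ k) 1)
    (M fun k => EuclideanSpace.single (φ k) (1 : ℝ))

theorem eval_diagPoly {j : ℕ}
    (M : ContinuousMultilinearMap ℝ (fun _ : Fin j => EuclideanSpace ℝ (Fin n)) ℝ)
    (s : EuclideanSpace ℝ (Fin n)) : eval (fun i => s i) (diagPoly M) = M fun _ => s := by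
  classical
  conv_rhs => rw [← euclidean_sum_single s]
  rw [M.map_sum, diagPoly, map_sum]
  refine Finset.sum_congr rfl fun φ _ => ?_
  rw [M.map_smul_univ, monomial_sum_index, map_mul, eval_C, map_prod, mul_comm, smul_eq_mul]
  congr 1
  exact Finset.prod_congr rfl fun k _ => eval_X _

theorem degree_sum_single {j : ℕ} (φ : Fin j → Fin n) :
    (∑ k, Finsupp.single (φ k) 1 : Fin n →₀ ℕ).degree = j := by
  simp

/-- Index tuples with the same monomial are rearrangements of one another, so all of them arise from
a fixed one by the `j!` permutations. -/
theorem card_filter_sum_single_le (j : ℕ) (m : Fin n →₀ ℕ) :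
    (Finset.univ.filter fun φ : Fin j → Fin n => ∑ k, Finsupp.single (φ k) 1 = m).card ≤
      j.factorial := by
  classical
  rcases Finset.eq_empty_or_nonempty
    (Finset.univ.filter fun φ : Fin j → Fin n => ∑ k, Finsupp.single (φ k) 1 = m) with h | ⟨φ₀, h₀⟩
  · rw [h]; simp
  · have hsub : (Finset.univ.filter fun φ : Fin j → Fin n => ∑ k, Finsupp.single (φ k) 1 = m) ⊆
        Finset.univ.image fun π : Equiv.Perm (Fin j) => φ₀ ∘ π := by
      intro φ hφ
      rw [Finset.mem_filter] at h₀ hφ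
      have hcard : ∀ (ψ : Fin j → Fin n) (i : Fin n), Fintype.card {k // ψ k = i} =
          (∑ k, Finsupp.single (ψ k) 1 : Fin n →₀ ℕ) i := by
        intro ψ i
        rw [Fintype.card_subtype, Finset.card_filter]
        simp [Finsupp.finsetSum_apply, Finsupp.single_apply]
      have e : ∀ i, Nonempty ({k // φ k = i} ≃ {k // φ₀ k = i}) := fun i =>
        Fintype.card_eq.mp (by rw [hcard, hcard, hφ.2, h₀.2])
      -- Fibres of `φ` and `φ₀` over each index have equal size; gluing bijections between them
      -- gives the permutation.
      refine Finset.mem_image.mpr ⟨Equiv.ofFiberEquiv fun i => (e i).some, Finset.mem_univ _, ?_⟩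
      ext1 k
      exact Equiv.ofFiberEquiv_map _ k
    refine (Finset.card_le_card hsub).trans (Finset.card_image_le.trans ?_)
    rw [Finset.card_univ, Fintype.card_perm, Fintype.card_fin]

theorem coeff_diagPoly_of_ne {j : ℕ}
    (M : ContinuousMultilinearMap ℝ (fun _ : Fin j => EuclideanSpace ℝ (Fin n)) ℝ)
    {m : Fin n →₀ ℕ} (hm : m.degree ≠ j) : (diagPoly M).coeff m = 0 := by
  classical
  rw [diagPoly, coeff_sum]
  refine Finset.sum_eq_zero fun φ _ => ?_
  rw [coeff_monomial, if_neg]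
  rintro rfl
  exact hm (degree_sum_single φ)

/-- At most `j!` index tuples contribute, each at most `‖M‖` because basis vectors are unit vectors.
The `j!` will cancel against the Taylor coefficient. -/
theorem abs_coeff_diagPoly_le {j : ℕ}
    (M : ContinuousMultilinearMap ℝ (fun _ : Fin j => EuclideanSpace ℝ (Fin n)) ℝ)
    (m : Fin n →₀ ℕ) : |(diagPoly M).coeff m| ≤ j.factorial * ‖M‖ := by
  classical
  rw [diagPoly, coeff_sum]
  simp only [coeff_monomial]
  rw [← Finset.sum_filter]
  refine (Finset.abs_sum_le_sum_abs _ _).trans ((Finset.sum_le_card_nsmul _ _ ‖M‖ fun φ _ => ?_).trans ?_)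
  · simpa using M.le_opNorm fun k => EuclideanSpace.single (φ k) (1 : ℝ)
  · rw [nsmul_eq_mul]
    gcongr
    exact_mod_cast card_filter_sum_single_le j m

end ARpSoS
end

/-! ### The value of the sum of squares program. -/

noncomputable section

namespace ARpSoS

open MvPolynomial Matrix

variable {n p : ℕ} {f : EuclideanSpace ℝ (Fin n) → ℝ}

theorem hessianMatrix_isHermitian (hf : ContDiff ℝ ((2 : ℕ) : ℕ∞) f)
    (x : EuclideanSpace ℝ (Fin n)) : (hessianMatrix f x).IsHermitian := by
  ext1 i j
  have : IsSymmSndFDerivAt ℝ f x := hf.contDiffAt.isSymmSndFDerivAt (by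
    rw [minSmoothness_of_isRCLikeNormedField]; rfl)
  simp only [hessianMatrix, conjTranspose_apply, of_apply, star_trivial]
  exact this.iteratedFDeriv_cons

theorem sum_hessianMatrix_mul (x s : EuclideanSpace ℝ (Fin n)) :
    ∑ i, ∑ j, hessianMatrix f x i j * (s i * s j) = iteratedFDeriv ℝ 2 f x (fun _ => s) := by
  rw [iteratedFDeriv_two_apply, Finset.sum_comm]
  conv_rhs => rw [← euclidean_sum_single s]
  simp only [map_sum, map_smul, _root_.sum_apply, _root_.smul_apply, smul_eq_mul]
  simp only [hessianMatrix, of_apply, iteratedFDeriv_two_apply, Finset.mul_sum]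
  refine Finset.sum_congr rfl fun i _ => Finset.sum_congr rfl fun j _ => ?_
  simp
  ring

theorem sum_smul_one_mul (c : ℝ) (s : EuclideanSpace ℝ (Fin n)) :
    ∑ i, ∑ j, (c • (1 : Matrix (Fin n) (Fin n) ℝ)) i j * (s i * s j) = c * ‖s‖ ^ 2 := by
  rw [EuclideanSpace.real_norm_sq_eq, Finset.mul_sum]
  simp [Matrix.one_apply, sq]

theorem posSemidef_add_smul_one_iff {A : Matrix (Fin n) (Fin n) ℝ} (hA : A.IsHermitian) (μ : ℝ) :
    (A + μ • (1 : Matrix (Fin n) (Fin n) ℝ)).PosSemidef ↔ ∀ r ∈ spectrum ℝ A, -μ ≤ r := by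
  rw [posSemidef_iff_isHermitian_and_spectrum_nonneg]
  have hH : (A + μ • (1 : Matrix (Fin n) (Fin n) ℝ)).IsHermitian := by
    refine hA.add ?_
    rw [IsHermitian, conjTranspose_smul, conjTranspose_one, star_trivial]
  have hmem : ∀ r, r + μ ∈ spectrum ℝ (A + μ • (1 : Matrix (Fin n) (Fin n) ℝ)) ↔
      r ∈ spectrum ℝ A := fun r => by
    rw [add_comm A, ← Algebra.algebraMap_eq_smul_one, spectrum.add_mem_add_iff]
  constructor
  · rintro ⟨-, h⟩ r hr
    have : 0 ≤ r + μ := h ((hmem r).2 hr)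
    linarith
  · intro h
    refine ⟨hH, fun r hr => ?_⟩
    rw [← sub_add_cancel r μ, hmem] at hr
    have := h _ hr
    show 0 ≤ r
    linarith

theorem posSemidef_hessianMatrix_add (hf : ContDiff ℝ ((2 : ℕ) : ℕ∞) f)
    (x : EuclideanSpace ℝ (Fin n)) {μ : ℝ} (hμ : 0 ≤ hessianLambdaMin f x + μ) :
    (hessianMatrix f x + μ • (1 : Matrix (Fin n) (Fin n) ℝ)).PosSemidef := by
  rw [posSemidef_add_smul_one_iff (hessianMatrix_isHermitian hf x)]
  intro r hr
  have : hessianLambdaMin f x ≤ r :=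
    csInf_le (Matrix.finite_real_spectrum (A := hessianMatrix f x)).bddBelow hr
  linarith

theorem neg_norm_le_hessianLambdaMin (hf : ContDiff ℝ ((2 : ℕ) : ℕ∞) f)
    (x : EuclideanSpace ℝ (Fin n)) : -‖iteratedFDeriv ℝ 2 f x‖ ≤ hessianLambdaMin f x := by
  have hH := hessianMatrix_isHermitian hf x
  have h : (hessianMatrix f x +
      ‖iteratedFDeriv ℝ 2 f x‖ • (1 : Matrix (Fin n) (Fin n) ℝ)).PosSemidef := by
    refine PosSemidef.of_dotProduct_mulVec_nonneg (hH.add ?_) fun v => ?_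
    · rw [IsHermitian, conjTranspose_smul, conjTranspose_one, star_trivial]
    · set s : EuclideanSpace ℝ (Fin n) := WithLp.toLp 2 v
      have h1 := sum_hessianMatrix_mul (f := f) x s
      have h2 := sum_smul_one_mul ‖iteratedFDeriv ℝ 2 f x‖ s
      have h3 : star v ⬝ᵥ ((hessianMatrix f x +
          ‖iteratedFDeriv ℝ 2 f x‖ • (1 : Matrix (Fin n) (Fin n) ℝ)) *ᵥ v) =
          iteratedFDeriv ℝ 2 f x (fun _ => s) + ‖iteratedFDeriv ℝ 2 f x‖ * ‖s‖ ^ 2 := by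
        rw [← h1, ← h2, ← Finset.sum_add_distrib]
        simp only [dotProduct, mulVec, Finset.mul_sum, star_trivial]
        refine Finset.sum_congr rfl fun i _ => ?_
        rw [← Finset.sum_add_distrib]
        refine Finset.sum_congr rfl fun j _ => ?_
        simp only [Matrix.add_apply, s]
        ring
      rw [h3]
      have h4 := (iteratedFDeriv ℝ 2 f x).le_opNorm fun _ => s
      rw [Finset.prod_const, Finset.card_univ, Fintype.card_fin, Real.norm_eq_abs] at h4
      linarith [neg_abs_le (iteratedFDeriv ℝ 2 f x fun _ => s)]
  rw [posSemidef_add_smul_one_iff hH] at h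
  -- For `n = 0` the spectrum is empty and the infimum takes the default value 0.
  rcases (spectrum ℝ (hessianMatrix f x)).eq_empty_or_nonempty with h0 | h0
  · rw [hessianLambdaMin, h0, Real.sInf_empty]
    exact neg_nonpos.mpr (norm_nonneg _)
  · exact le_csInf h0 h

theorem IsPerturbation.le_add {lam δ c : ℝ} (h : IsPerturbation lam δ c) : δ ≤ lam + c := by
  rcases h with ⟨h, rfl⟩ | ⟨h, rfl⟩ | ⟨h, h', rfl⟩ <;> linarith

theorem IsPerturbation.nonneg {lam δ c : ℝ} (h : IsPerturbation lam δ c) (hδ : 0 ≤ δ) : 0 ≤ c := by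
  rcases h with ⟨h, rfl⟩ | ⟨h, rfl⟩ | ⟨h, h', rfl⟩ <;> linarith

theorem IsPerturbation.le_add_one {lam δ c b : ℝ} (h : IsPerturbation lam δ c) (hδ : δ ≤ 1)
    (hb : 0 ≤ b) (hlam : -b ≤ lam) : c ≤ b + 1 := by
  rcases h with ⟨h, rfl⟩ | ⟨h, rfl⟩ | ⟨h, h', rfl⟩ <;> linarith

theorem fderiv_eq_sum (x s : EuclideanSpace ℝ (Fin n)) :
    ∑ i, fderiv ℝ f x (EuclideanSpace.single i 1) * s i = iteratedFDeriv ℝ 1 f x fun _ => s := by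
  rw [iteratedFDeriv_one_apply]
  conv_rhs => rw [← euclidean_sum_single s]
  rw [map_sum]
  exact Finset.sum_congr rfl fun i _ => by rw [map_smul, smul_eq_mul, mul_comm]

/-- The model with `σ = (p' δ / 2) r^(-p)` is an affine part, plus half the form of `∇²f(x) + (c -
δ) I`, plus `(δ r² / 2) (‖u‖² + ‖u‖^p' + q(u))` at `u = s / r`. The form is positive semidefinite by
the choice of `c`, and the smallness of `r` puts the coefficients of `q` below R. -/
theorem sosSigma_le_of_scaling {R δ c r : ℝ} {Λ : ℕ → ℝ} (hp : 4 ≤ p) (hpe : Even p)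
    (hR : IsSoSRadius n p R) (hf : ContDiff ℝ (p : ℕ∞) f) {x : EuclideanSpace ℝ (Fin n)}
    (hΛ : ∀ j ∈ Finset.Icc 1 p, ‖iteratedFDeriv ℝ j f x‖ ≤ Λ j) (hδ : 0 < δ)
    (hc : IsPerturbation (hessianLambdaMin f x) δ c) (hr : 0 < r) (hr1 : r ≤ 1)
    (hrS : r * ∑ j ∈ Finset.Icc 3 p, 2 * Λ j / R ≤ δ) :
    sosSigma f p x c ≤ (regOrder p : ℝ) * δ / 2 * (1 / r) ^ p := by
  obtain ⟨hR0, hR⟩ := hR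
  have hΛ0 : ∀ j ∈ Finset.Icc 3 p, 0 ≤ Λ j := fun j hj =>
    (norm_nonneg _).trans (hΛ j (Finset.Icc_subset_Icc_left (by norm_num) hj))
  -- Chosen so that `(δ r² / 2) a_j r^(-j) = 1 / j!`, which restores the Taylor coefficients after
  -- rescaling.
  set a : ℕ → ℝ := fun j => 2 * r ^ (j - 2) / (δ * j.factorial) with ha
  set q : MvPolynomial (Fin n) ℝ := ∑ j ∈ Finset.Icc 3 p, C (a j) * diagPoly (iteratedFDeriv ℝ j f x)
    with hq
  have hcoeff : ∀ m, q.coeff m = if m.degree ∈ Finset.Icc 3 p then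
      a m.degree * (diagPoly (iteratedFDeriv ℝ m.degree f x)).coeff m else 0 := by
    intro m
    simp only [hq, coeff_sum, coeff_C_mul]
    split_ifs with hm
    · exact Finset.sum_eq_single_of_mem _ hm fun j _ hj => by
        rw [coeff_diagPoly_of_ne _ (Ne.symm hj), mul_zero]
    · refine Finset.sum_eq_zero fun j hj => ?_
      rw [coeff_diagPoly_of_ne _ (fun h => hm (h ▸ hj)), mul_zero]
  have hqdeg : q.totalDegree ≤ p := by
    refine Finset.sup_le fun m hm => ?_
    rw [mem_support_iff, hcoeff] at hm
    by_contra hlt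
    exact hm (if_neg fun h => hlt (Finset.mem_Icc.mp h).2)
  have hqR : ∀ m, |q.coeff m| ≤ R := by
    intro m
    rw [hcoeff]
    split_ifs with hm
    · set j := m.degree
      have hj3 : 3 ≤ j := (Finset.mem_Icc.mp hm).1
      -- Here `j ≥ 3` matters: at least one factor `r` remains to make the coefficient small.
      have h1 : r ^ (j - 2) ≤ r := pow_le_of_le_one hr.le hr1 (by omega)
      have h2 : 2 * Λ j / R ≤ ∑ j ∈ Finset.Icc 3 p, 2 * Λ j / R :=
        Finset.single_le_sum (f := fun j => 2 * Λ j / R)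
          (fun i hi => div_nonneg (mul_nonneg zero_le_two (hΛ0 i hi)) hR0.le) hm
      have h3 : r * (2 * Λ j / R) ≤ δ := (mul_le_mul_of_nonneg_left h2 hr.le).trans hrS
      have h4 := abs_coeff_diagPoly_le (iteratedFDeriv ℝ j f x) m
      have h5 : (0 : ℝ) < j.factorial := by exact_mod_cast j.factorial_pos
      have ha0 : 0 ≤ a j := by simp only [ha]; positivity
      rw [abs_mul, abs_of_nonneg ha0]
      calc a j * |(diagPoly (iteratedFDeriv ℝ j f x)).coeff m|
          ≤ a j * (j.factorial * Λ j) := by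
            refine mul_le_mul_of_nonneg_left (h4.trans ?_) ha0
            exact mul_le_mul_of_nonneg_left
              (hΛ j (Finset.Icc_subset_Icc_left (by norm_num) hm)) h5.le
        _ = r ^ (j - 2) * (2 * Λ j) / δ := by simp only [ha]; field_simp
        _ ≤ r * (2 * Λ j) / δ := by
            have := hΛ0 j hm
            gcongr
        _ ≤ R := by
            rw [div_le_iff₀ hδ]
            rw [mul_div_assoc', div_le_iff₀ hR0] at h3
            linarith
    · simpa using hR0.le
  obtain ⟨P, hP, hPS⟩ := hR q hqdeg hqR
  set A : Matrix (Fin n) (Fin n) ℝ :=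
    (1 / 2 : ℝ) • (hessianMatrix f x + (c - δ) • (1 : Matrix (Fin n) (Fin n) ℝ)) with hA
  have hf2 : ContDiff ℝ ((2 : ℕ) : ℕ∞) f := hf.of_le (by exact_mod_cast (by omega : 2 ≤ p))
  have hApos : A.PosSemidef :=
    (posSemidef_hessianMatrix_add hf2 x (by linarith [hc.le_add])).smul (by norm_num)
  have hpow : (1 / r) ^ p = 1 / r ^ p := by rw [div_pow, one_pow]
  refine csInf_le ⟨0, fun σ hσ => hσ.1⟩ ⟨by positivity,
    C (δ / 2 * r ^ 2) * bind₁ (fun k => C (1 / r) * X k) P + quadPoly A +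
      (C (f x) + ∑ i, C (fderiv ℝ f x (EuclideanSpace.single i 1)) * X i), fun s => ?_, ?_⟩
  · have hr' : regOrder p = p + 2 := regOrder_of_even hpe
    have e1 : eval (fun i => s i) (bind₁ (fun k => C (1 / r) * X k) P) =
        eval (fun i => ((1 / r) • s) i) P := by
      refine (eval₂Hom_bind₁ _ _ _ _).trans ?_
      congr 2
      funext i
      simp
    have e2 : eval (fun i => s i) (quadPoly A) =
        1 / 2 * (iteratedFDeriv ℝ 2 f x (fun _ => s) + (c - δ) * ‖s‖ ^ 2) := by
      rw [← sum_hessianMatrix_mul, ← sum_smul_one_mul, ← Finset.sum_add_distrib, Finset.mul_sum]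
      simp only [quadPoly, map_sum, map_mul, eval_C, eval_X]
      refine Finset.sum_congr rfl fun i _ => ?_
      rw [← Finset.sum_add_distrib, Finset.mul_sum]
      refine Finset.sum_congr rfl fun j _ => ?_
      simp only [hA, Matrix.smul_apply, Matrix.add_apply, smul_eq_mul]
      ring
    have e3 : eval (fun i => ((1 / r) • s) i) q =
        ∑ j ∈ Finset.Icc 3 p, a j * (1 / r) ^ j * iteratedFDeriv ℝ j f x (fun _ => s) := by
      simp only [hq, map_sum, map_mul, eval_C]
      refine Finset.sum_congr rfl fun j _ => ?_
      rw [eval_diagPoly, ContinuousMultilinearMap.map_smul_univ (iteratedFDeriv ℝ j f x)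
        (fun _ => 1 / r) (fun _ => s)]
      simp [mul_assoc]
    have e4 : ∀ j ∈ Finset.Icc 3 p, δ / 2 * r ^ 2 *
        (a j * (1 / r) ^ j * iteratedFDeriv ℝ j f x (fun _ => s)) =
        1 / j.factorial * iteratedFDeriv ℝ j f x (fun _ => s) := by
      intro j hj
      obtain ⟨i, rfl⟩ := Nat.exists_eq_add_of_le' (by have := (Finset.mem_Icc.mp hj).1; omega : 2 ≤ j)
      have h5 : ((i + 2).factorial : ℝ) ≠ 0 := by exact_mod_cast (i + 2).factorial_ne_zero
      simp only [ha, Nat.add_sub_cancel, div_pow, one_pow]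
      field_simp
      ring
    have e5 : ∀ g : ℕ → ℝ, ∑ j ∈ Finset.Icc 1 p, g j = g 1 + g 2 + ∑ j ∈ Finset.Icc 3 p, g j := by
      intro g
      change ∑ j ∈ Finset.Ico 1 (p + 1), g j = g 1 + g 2 + ∑ j ∈ Finset.Ico 3 (p + 1), g j
      rw [Finset.sum_eq_sum_Ico_succ_bot (by omega), Finset.sum_eq_sum_Ico_succ_bot (by omega)]
      exact (add_assoc _ _ _).symm
    have hPs := hP ((1 / r) • s)
    beta_reduce at hPs
    rw [map_add, map_add, map_add, map_mul, eval_C, e1, hPs, e2, e3, eval_C, map_sum]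
    simp only [map_mul, eval_C, eval_X, fderiv_eq_sum]
    rw [mul_add, Finset.mul_sum, Finset.sum_congr rfl e4, sosTaylorModel, taylorModel, e5, norm_smul,
      Real.norm_of_nonneg (by positivity), hr', hpow]
    have : ((p + 2 : ℕ) : ℝ) ≠ 0 := by positivity
    simp only [Nat.factorial, mul_pow, div_pow, one_pow]
    push_cast
    field_simp
    ring
  · rw [polyHessian_add, polyHessian_add, polyHessian_linear, add_zero, polyHessian_C_mul,
      polyHessian_quadPoly]
    exact ((hPS.polyHessian_bind₁ (1 / r)).smul (isSumSq_C (by positivity))).add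
      (isSoSMatrix_map_C (hApos.add hApos.transpose))

/-- The largest admissible scale is `r = min {1, δ / S}`. The value 1 gives `p' δ / 2`, and `δ / S`
gives `(p' / 2) S^p δ^(1 - p)`, where `1 - p = 3 - p'`. -/
theorem sosSigma_le {R δ c : ℝ} {Λ : ℕ → ℝ} (hp : 4 ≤ p) (hpe : Even p)
    (hR : IsSoSRadius n p R) (hf : ContDiff ℝ (p : ℕ∞) f) {x : EuclideanSpace ℝ (Fin n)}
    (hΛ : ∀ j ∈ Finset.Icc 1 p, ‖iteratedFDeriv ℝ j f x‖ ≤ Λ j) (hδ : 0 < δ)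
    (hc : IsPerturbation (hessianLambdaMin f x) δ c) :
    sosSigma f p x c ≤ max ((regOrder p : ℝ) * δ / 2)
      (constC p R Λ * δ ^ ((3 : ℝ) - (regOrder p : ℝ))) := by
  set S := ∑ j ∈ Finset.Icc 3 p, 2 * Λ j / R with hS
  rcases le_or_gt S δ with h | h
  · refine le_max_of_le_left ?_
    simpa using sosSigma_le_of_scaling hp hpe hR hf hΛ hδ hc one_pos le_rfl (by rwa [one_mul])
  · have hS0 : 0 < S := hδ.trans h
    refine le_max_of_le_right ((sosSigma_le_of_scaling hp hpe hR hf hΛ hδ hc (div_pos hδ hS0)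
      ((div_le_one hS0).mpr h.le) (by rw [div_mul_cancel₀ _ hS0.ne'])).trans_eq ?_)
    have hr' : regOrder p = p + 2 := regOrder_of_even hpe
    rw [constC, ← hS, hr', Nat.add_sub_cancel]
    have : (3 : ℝ) - ((p + 2 : ℕ) : ℝ) = 1 - (p : ℕ) := by push_cast; ring
    rw [this, Real.rpow_sub hδ, Real.rpow_one, Real.rpow_natCast, one_div_div, div_pow]
    push_cast
    field_simp

end ARpSoS
end

/-! ### Unsuccessful steps and the bound along a run. -/

noncomputable section

namespace ARpSoS

variable {n p : ℕ} {f : EuclideanSpace ℝ (Fin n) → ℝ}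

theorem taylorModel_zero (x : EuclideanSpace ℝ (Fin n)) : taylorModel f p x 0 = f x := by
  rw [taylorModel, Finset.sum_eq_zero, add_zero]
  intro j hj
  obtain ⟨i, rfl⟩ := Nat.exists_eq_add_of_le' (Finset.mem_Icc.mp hj).1
  rw [ContinuousMultilinearMap.map_coord_zero _ (0 : Fin (i + 1)) rfl, mul_zero]

theorem sosTaylorModel_zero (hpe : Even p) (x : EuclideanSpace ℝ (Fin n)) (c σ : ℝ) :
    sosTaylorModel f p x c σ 0 = f x := by
  simp [sosTaylorModel, taylorModel_zero, regOrder_of_even hpe]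

theorem norm_gradient_eq_norm_fderiv (y : EuclideanSpace ℝ (Fin n)) :
    ‖gradient f y‖ = ‖fderiv ℝ f y‖ := by
  rw [gradient, LinearIsometryEquiv.norm_map]

theorem taylorModelFDeriv_zero (hp : 1 ≤ p) (x : EuclideanSpace ℝ (Fin n)) :
    taylorModelFDeriv f p x 0 = fderiv ℝ f x := by
  obtain ⟨q, rfl⟩ := Nat.exists_eq_add_of_le' hp
  rw [taylorModelFDeriv, Finset.sum_range_succ', Finset.sum_eq_zero, zero_add]
  · simp
  · intro j _
    rw [ContinuousMultilinearMap.map_coord_zero _ (0 : Fin (j + 1)) rfl, smul_zero]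

theorem norm_taylorModelFDeriv_sub_le {Λ : ℕ → ℝ} (hp : 2 ≤ p) {x s : EuclideanSpace ℝ (Fin n)}
    (hΛ : ∀ j ∈ Finset.Icc 1 p, ‖iteratedFDeriv ℝ j f x‖ ≤ Λ j) (hs : ‖s‖ ≤ 1) :
    ‖taylorModelFDeriv f p x s - fderiv ℝ f x‖ ≤ (Λ 2 + ∑ j ∈ Finset.Icc 3 p, Λ j) * ‖s‖ := by
  have hsum : Λ 2 + ∑ j ∈ Finset.Icc 3 p, Λ j = ∑ j ∈ Finset.range (p - 1), Λ (j + 2) := by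
    have h1 := Finset.sum_Ico_add' Λ 0 (p - 1) 2
    rw [Nat.Ico_zero_eq_range, zero_add, show p - 1 + 2 = p + 1 by omega,
      Finset.sum_eq_sum_Ico_succ_bot (by omega)] at h1
    exact h1.symm
  obtain ⟨q, rfl⟩ := Nat.exists_eq_add_of_le' (by omega : 1 ≤ p)
  rw [taylorModelFDeriv, Finset.sum_range_succ', hsum, Finset.sum_mul, Nat.add_sub_cancel]
  have h0 : (1 / (Nat.factorial 0 : ℝ)) • iteratedFDeriv ℝ 0 (fderiv ℝ f) x (fun _ => s) =
      fderiv ℝ f x := by simp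
  rw [h0, add_sub_cancel_right]
  refine (norm_sum_le _ _).trans (Finset.sum_le_sum fun j hj => ?_)
  have hj' : j + 2 ∈ Finset.Icc 1 (q + 1) := by
    have := Finset.mem_range.mp hj
    exact Finset.mem_Icc.mpr ⟨by omega, by omega⟩
  have h1 := (iteratedFDeriv ℝ (j + 1) (fderiv ℝ f) x).le_opNorm fun _ => s
  rw [norm_iteratedFDeriv_fderiv, Finset.prod_const, Finset.card_univ, Fintype.card_fin] at h1
  have h2 : ‖s‖ ^ (j + 1) ≤ ‖s‖ := pow_le_of_le_one (norm_nonneg _) hs (by omega)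
  have h3 : (1 : ℝ) ≤ (j + 1).factorial := by exact_mod_cast (j + 1).factorial_pos
  rw [norm_smul, Real.norm_of_nonneg (by positivity)]
  calc 1 / ((j + 1).factorial : ℝ) * ‖iteratedFDeriv ℝ (j + 1) (fderiv ℝ f) x fun _ => s‖
      ≤ 1 * ‖iteratedFDeriv ℝ (j + 1) (fderiv ℝ f) x fun _ => s‖ := by
        gcongr
        exact div_le_one_of_le₀ h3 (by positivity)
    _ ≤ Λ (j + 2) * ‖s‖ := by
        rw [one_mul]
        refine h1.trans (mul_le_mul (hΛ _ hj') h2 (by positivity) ((norm_nonneg _).trans (hΛ _ hj')))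

theorem constA_pos {L η : ℝ} (hL0 : 0 < L) (hη1 : η < 1) (hpe : Even p) : 0 < constA p L η := by
  have h : 0 < 1 - η := by linarith
  rw [constA, regOrder_of_even hpe]
  positivity

section UnsuccessfulStep

variable {L η c σ ε : ℝ} {Λ : ℕ → ℝ} {x s : EuclideanSpace ℝ (Fin n)}

theorem step_ne_zero (hp : 1 ≤ p) (hpe : Even p) (hf : ContDiff ℝ (p : ℕ∞) f)
    (hs : ∀ v, sosTaylorModel f p x c σ s ≤ sosTaylorModel f p x c σ v)
    (hx : fderiv ℝ f x ≠ 0) : s ≠ 0 := by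
  rintro rfl
  have h := taylorModelFDeriv_add_eq_zero hpe hf hs
  rw [taylorModelFDeriv_zero hp, map_zero, smul_zero, add_zero] at h
  exact hx h

/-- At an unsuccessful step, the regularization parameter times the step length is bounded. -/
theorem mul_norm_step_le_constA (hp : 1 ≤ p) (hpe : Even p) (hL0 : 0 < L)
    (hf : ContDiff ℝ (p : ℕ∞) f)
    (hL : ∀ y z, ‖iteratedFDeriv ℝ p f y - iteratedFDeriv ℝ p f z‖ ≤
      ((p - 1).factorial : ℝ) * L * ‖y - z‖)
    (hη1 : η < 1) (hσ : 0 < σ) (hc : 0 ≤ c)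
    (hs : ∀ v, sosTaylorModel f p x c σ s ≤ sosTaylorModel f p x c σ v)
    (hs0 : s ≠ 0) (hρ : ¬ η < decreaseRatio f p x s) : σ * ‖s‖ ≤ constA p L η := by
  have hn : 0 < ‖s‖ := norm_pos_iff.mpr hs0
  have h1 := hs 0
  rw [sosTaylorModel_zero hpe, sosTaylorModel, regOrder_of_even hpe] at h1
  have hT := (abs_le.mp (abs_sub_taylorModel_le hp hL0.le hf hL x s)).2
  have hq : (0 : ℝ) < (p + 2 : ℕ) := by positivity
  have hp1 : (0 : ℝ) < p + 1 := by positivity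
  have hσn : 0 < σ / (p + 2 : ℕ) * ‖s‖ ^ (p + 2) := by positivity
  have hcn : 0 ≤ c / 2 * ‖s‖ ^ 2 := by positivity
  have hη : 0 < 1 - η := by linarith
  have hden : 0 < f x - taylorModel f p x s := by linarith
  rw [not_lt, decreaseRatio, div_le_iff₀ hden] at hρ
  -- Failure means that `1 - η` times the predicted decrease is at most the Taylor error; since `s`
  -- does no worse than the zero step, that decrease is at least the regularization term.
  have h2 : (1 - η) * (σ / (p + 2 : ℕ) * ‖s‖ ^ (p + 2)) ≤ L / (p + 1) * ‖s‖ ^ (p + 1) :=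
    calc (1 - η) * (σ / (p + 2 : ℕ) * ‖s‖ ^ (p + 2))
        ≤ (1 - η) * (f x - taylorModel f p x s) :=
          mul_le_mul_of_nonneg_left (by linarith) hη.le
      _ ≤ L / (p + 1) * ‖s‖ ^ (p + 1) := by linarith
  have h3 : (1 - η) * (σ / (p + 2 : ℕ) * ‖s‖) ≤ L / (p + 1) := by
    refine le_of_mul_le_mul_right ?_ (pow_pos hn (p + 1))
    calc _ = (1 - η) * (σ / (p + 2 : ℕ) * ‖s‖ ^ (p + 2)) := by ring
      _ ≤ _ := h2
  rw [constA, regOrder_of_even hpe, le_div_iff₀ (by positivity)]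
  rw [le_div_iff₀ hp1] at h3
  calc σ * ‖s‖ * ((p + 1) * (1 - η))
      = (1 - η) * (σ / (p + 2 : ℕ) * ‖s‖) * (p + 1) * (p + 2 : ℕ) := by field_simp
    _ ≤ L * (p + 2 : ℕ) := by gcongr

theorem norm_smul_innerSL_le (hc : 0 ≤ c) (hσ : 0 ≤ σ) :
    ‖(c + σ * ‖s‖ ^ p) • innerSL (E := EuclideanSpace ℝ (Fin n)) ℝ s‖ ≤
      c * ‖s‖ + σ * ‖s‖ * ‖s‖ ^ p := by
  rw [norm_smul, innerSL_apply_norm, Real.norm_of_nonneg (by positivity)]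
  exact le_of_eq (by ring)

theorem le_constB'_mul_inv (hp : 4 ≤ p) (hpe : Even p) (hf : ContDiff ℝ (p : ℕ∞) f)
    (hΛ : ∀ j ∈ Finset.Icc 1 p, ‖iteratedFDeriv ℝ j f x‖ ≤ Λ j)
    (hε : 0 < ε) (hε1 : ε < 1) (hx : ε < ‖fderiv ℝ f x‖) (hA0 : 0 < constA p L η)
    (hσ : 0 < σ) (hc : 0 ≤ c) (hcΛ : c ≤ Λ 2 + 1)
    (hs : ∀ v, sosTaylorModel f p x c σ s ≤ sosTaylorModel f p x c σ v)
    (hA : σ * ‖s‖ ≤ constA p L η) : σ ≤ constB' p L η Λ * ε⁻¹ := by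
  have hΛ0 : ∀ j ∈ Finset.Icc 1 p, 0 ≤ Λ j := fun j hj => (norm_nonneg _).trans (hΛ j hj)
  have hΛ2 : 0 ≤ Λ 2 := hΛ0 2 (Finset.mem_Icc.mpr ⟨by norm_num, by omega⟩)
  have hS : 0 ≤ ∑ j ∈ Finset.Icc 3 p, Λ j :=
    Finset.sum_nonneg fun j hj => hΛ0 j (Finset.Icc_subset_Icc_left (by norm_num) hj)
  rw [constB']
  set A := constA p L η
  set S := ∑ j ∈ Finset.Icc 3 p, Λ j
  rw [← div_eq_mul_inv, le_div_iff₀ hε]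
  -- Short steps: stationarity bounds the gradient at `x` by a multiple of `‖s‖`, hence `ε` too.
  -- Long steps: `σ ≤ σ ‖s‖ ≤ A₀` already suffices.
  rcases le_total ‖s‖ 1 with h1 | h1
  · have hstat := taylorModelFDeriv_add_eq_zero hpe hf hs
    have e : fderiv ℝ f x = -(taylorModelFDeriv f p x s - fderiv ℝ f x) -
        (c + σ * ‖s‖ ^ p) • innerSL (E := EuclideanSpace ℝ (Fin n)) ℝ s := by
      rw [← sub_eq_zero, ← hstat]; abel
    have h2 : ‖fderiv ℝ f x‖ ≤ (Λ 2 + S) * ‖s‖ + (c * ‖s‖ + σ * ‖s‖ * ‖s‖ ^ p) := by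
      rw [e]
      refine (norm_sub_le _ _).trans (add_le_add ?_ (norm_smul_innerSL_le hc hσ.le))
      rw [norm_neg]
      exact norm_taylorModelFDeriv_sub_le (by omega) hΛ h1
    have h3 : ‖s‖ ^ p ≤ ‖s‖ := pow_le_of_le_one (norm_nonneg _) h1 (by omega)
    have h4 : σ * ‖s‖ * ‖s‖ ^ p ≤ A * ‖s‖ := mul_le_mul hA h3 (by positivity) hA0.le
    have h5 : c * ‖s‖ ≤ (Λ 2 + 1) * ‖s‖ := mul_le_mul_of_nonneg_right hcΛ (norm_nonneg _)
    have h6 : ε ≤ (1 + 2 * Λ 2 + S + A) * ‖s‖ := by linarith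
    calc σ * ε ≤ σ * ((1 + 2 * Λ 2 + S + A) * ‖s‖) := by gcongr
      _ = (σ * ‖s‖) * (1 + 2 * Λ 2 + S + A) := by ring
      _ ≤ A * (1 + 2 * Λ 2 + S + A) := by gcongr
  · calc σ * ε ≤ σ * ‖s‖ := by gcongr; linarith
      _ ≤ A * 1 := by rwa [mul_one]
      _ ≤ A * (1 + 2 * Λ 2 + S + A) := by gcongr; linarith

theorem le_constB_mul_inv (hp : 1 ≤ p) (hpe : Even p) (hL0 : 0 < L)
    (hf : ContDiff ℝ (p : ℕ∞) f)
    (hL : ∀ y z, ‖iteratedFDeriv ℝ p f y - iteratedFDeriv ℝ p f z‖ ≤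
      ((p - 1).factorial : ℝ) * L * ‖y - z‖)
    (hε : 0 < ε) (hε1 : ε < 1) (hx : ε < ‖fderiv ℝ f (x + s)‖) (hA0 : 0 < constA p L η)
    (hσ : 0 < σ) (hc : 0 ≤ c) (hcΛ : c ≤ Λ 2 + 1)
    (hs : ∀ v, sosTaylorModel f p x c σ s ≤ sosTaylorModel f p x c σ v)
    (hs0 : s ≠ 0) (hA : σ * ‖s‖ ≤ constA p L η) : σ ≤ constB p L η Λ * ε⁻¹ := by
  have hn : 0 < ‖s‖ := norm_pos_iff.mpr hs0
  have hstat := taylorModelFDeriv_add_eq_zero hpe hf hs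
  rw [constB]
  set A := constA p L η
  set M := max 1 (max (Λ 2 + 1) ((L + A) ^ (1 / (p : ℝ))))
  have hM1 : 1 ≤ M := le_max_left _ _
  have hM2 : Λ 2 + 1 ≤ M := (le_max_left _ _).trans (le_max_right _ _)
  have hM3 : (L + A) ^ (1 / (p : ℝ)) ≤ M := (le_max_right _ _).trans (le_max_right _ _)
  -- The `p`-th root in `M` allows `(L + A) ‖s‖^p` to be absorbed into `(M ‖s‖)^p`, so that only the
  -- size of `M ‖s‖` matters.
  have hMp : L + A ≤ M ^ p := by
    have h := pow_le_pow_left₀ (by positivity) hM3 p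
    rwa [one_div, Real.rpow_inv_natCast_pow (by positivity) (by omega)] at h
  have e : fderiv ℝ f (x + s) = (fderiv ℝ f (x + s) - taylorModelFDeriv f p x s) -
      (c + σ * ‖s‖ ^ p) • innerSL (E := EuclideanSpace ℝ (Fin n)) ℝ s := by
    rw [← sub_eq_zero, ← hstat]; abel
  have h2 : ‖fderiv ℝ f (x + s)‖ ≤ L * ‖s‖ ^ p + (c * ‖s‖ + σ * ‖s‖ * ‖s‖ ^ p) := by
    rw [e]
    exact (norm_sub_le _ _).trans (add_le_add
      (norm_fderiv_sub_taylorModelFDeriv_le hp hL0.le hf hL x s) (norm_smul_innerSL_le hc hσ.le))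
  have h4 : σ * ‖s‖ * ‖s‖ ^ p ≤ A * ‖s‖ ^ p := by gcongr
  have h5 : c * ‖s‖ ≤ M * ‖s‖ := mul_le_mul_of_nonneg_right (hcΛ.trans hM2) (norm_nonneg _)
  have h6 : (L + A) * ‖s‖ ^ p ≤ (M * ‖s‖) ^ p := by
    rw [mul_pow]; gcongr
  -- If `M ‖s‖ ≤ 1`, the power is dominated by its base and 2 would do as factor; otherwise `ε < 1`
  -- is enough.
  have h7 : ε ≤ 4 * (M * ‖s‖) := by
    rcases le_total (M * ‖s‖) 1 with h | h
    · have : (M * ‖s‖) ^ p ≤ M * ‖s‖ := pow_le_of_le_one (by positivity) h (by omega)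
      have : 0 ≤ M * ‖s‖ := by positivity
      linarith
    · linarith
  rw [← div_eq_mul_inv, le_div_iff₀ hε]
  calc σ * ε ≤ σ * (4 * (M * ‖s‖)) := by gcongr
    _ = 4 * (σ * ‖s‖) * M := by ring
    _ ≤ 4 * A * M := by gcongr

end UnsuccessfulStep

/-- Since `ε < 1`, the factor `ε⁻¹ ≥ 1` absorbs the terms without a negative power, and the smaller
exponent gives the larger power. The regimes change where `a (p - 1) = 1`. -/
theorem sigmaBounds_of_le {ε a γ₁ σ₀ B C σ : ℝ} (hp : 2 ≤ p) (hpe : Even p) (hε : 0 < ε)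
    (hε1 : ε < 1) (hσ₀ : 0 ≤ σ₀)
    (h : σ ≤ max σ₀ (max (γ₁ * B * ε⁻¹) (max ((regOrder p : ℝ) * ε ^ a / 2)
      (C * (ε ^ a) ^ ((3 : ℝ) - (regOrder p : ℝ)))))) :
    SigmaBounds p ε a γ₁ σ₀ B C σ := by
  have hp1 : (0 : ℝ) < (p : ℝ) - 1 := by
    have : (2 : ℝ) ≤ p := by exact_mod_cast hp
    linarith
  have hpow : (ε ^ a) ^ ((3 : ℝ) - (regOrder p : ℝ)) = ε ^ (a * (1 - (p : ℝ))) := by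
    rw [← Real.rpow_mul hε.le, regOrder_of_even hpe]
    congr 2
    push_cast
    ring
  have hE : ε⁻¹ = ε ^ (-1 : ℝ) := (Real.rpow_neg_one ε).symm
  have hE1 : 1 ≤ ε⁻¹ := (one_le_inv₀ hε).mpr hε1.le
  set C' := max σ₀ (max (γ₁ * B) (max ((regOrder p : ℝ) * ε ^ a / 2) C)) with hC'
  have hC0 : 0 ≤ C' := hσ₀.trans (le_max_left _ _)
  have h1 : σ₀ ≤ C' := le_max_left _ _
  have h2 : γ₁ * B ≤ C' := (le_max_left _ _).trans (le_max_right _ _)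
  have h3 : (regOrder p : ℝ) * ε ^ a / 2 ≤ C' :=
    ((le_max_left _ _).trans (le_max_right _ _)).trans (le_max_right _ _)
  have h4 : C ≤ C' := ((le_max_right _ _).trans (le_max_right _ _)).trans (le_max_right _ _)
  set M := max ε⁻¹ (ε ^ (a * (1 - (p : ℝ))))
  have hM1 : 1 ≤ M := hE1.trans (le_max_left _ _)
  have hM0 : 0 ≤ M := zero_le_one.trans hM1
  have main : σ ≤ C' * M := by
    refine h.trans (max_le ?_ (max_le ?_ (max_le ?_ ?_)))
    · exact h1.trans (le_mul_of_one_le_right hC0 hM1)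
    · exact mul_le_mul h2 (le_max_left _ _) (by positivity) hC0
    · exact h3.trans (le_mul_of_one_le_right hC0 hM1)
    · rw [hpow]
      exact mul_le_mul h4 (le_max_right _ _) (by positivity) hC0
  have hM : M = ε ^ (-max 1 (a * ((p : ℝ) - 1))) := by
    rcases le_total 1 (a * ((p : ℝ) - 1)) with h' | h'
    · rw [max_eq_right h', show -(a * ((p : ℝ) - 1)) = a * (1 - p) by ring]
      refine max_eq_right ?_
      rw [hE]
      exact Real.rpow_le_rpow_of_exponent_ge hε hε1.le (by linarith)
    · rw [max_eq_left h', ← hE]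
      refine max_eq_left ?_
      rw [hE]
      exact Real.rpow_le_rpow_of_exponent_ge hε hε1.le (by linarith)
  refine ⟨h, main, hM ▸ main, fun h' => ?_, fun h' => ?_⟩
  · rw [le_div_iff₀ hp1] at h'
    rwa [hM, max_eq_left h', ← hE] at main
  · rw [div_le_iff₀ hp1] at h'
    rwa [hM, max_eq_right h', show -(a * ((p : ℝ) - 1)) = a * (1 - p) by ring] at main

section Run

variable {ε δ σmin η γ₁ γ₂ : ℝ} {x s : ℕ → EuclideanSpace ℝ (Fin n)} {σr σ c : ℕ → ℝ}

theorem Performed.of_succ {k : ℕ} (h : Performed f ε x (k + 1)) : Performed f ε x k :=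
  fun j hj => h j (hj.trans k.le_succ)

theorem IsRun.sigma_pos (hrun : IsRun f p ε δ σmin η γ₁ γ₂ x s σr σ c) (hσmin : 0 < σmin)
    (hγ₁ : 1 < γ₁) {k : ℕ} (hk : Performed f ε x k) : 0 < σ k := by
  rw [hrun.sigma_eq k hk]
  refine lt_max_of_lt_right ?_
  cases k with
  | zero => rwa [hrun.reg_zero]
  | succ k =>
    have ih := hrun.sigma_pos hσmin hγ₁ hk.of_succ
    by_cases hρ : η < decreaseRatio f p (x k) (s k)
    · rw [(hrun.successful k hk.of_succ hρ).2]
      exact lt_max_of_lt_right hσmin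
    · rw [(hrun.unsuccessful k hk.of_succ hρ).2]
      exact mul_pos (by linarith) ih

theorem IsRun.sigmin_le (hrun : IsRun f p ε δ σmin η γ₁ γ₂ x s σr σ c)
    (h0 : Performed f ε x 0) : σmin ≤ σ 0 := by
  rw [hrun.sigma_eq 0 h0, hrun.reg_zero]
  exact le_max_right _ _

/-- A bound for `σ_k` from a bound at unsuccessful iterations and a bound for the value of the sum
of squares program. -/
theorem IsRun.sigma_le (hrun : IsRun f p ε δ σmin η γ₁ γ₂ x s σr σ c) (hσmin : 0 < σmin)
    (hγ₁ : 1 < γ₁) (hγ₂ : γ₂ < 1) {b d : ℝ}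
    (hb : ∀ k, Performed f ε x k → ¬ η < decreaseRatio f p (x k) (s k) → σ k ≤ b)
    (hd : ∀ k, Performed f ε x k → sosSigma f p (x k) (c k) ≤ d) {k : ℕ}
    (hk : Performed f ε x k) : σ k ≤ max (σ 0) (max (γ₁ * b) d) := by
  induction k with
  | zero => exact le_max_left _ _
  | succ k ih =>
    have ih := ih hk.of_succ
    rw [hrun.sigma_eq _ hk]
    refine max_le ((hd _ hk).trans ((le_max_right _ _).trans (le_max_right _ _))) ?_
    by_cases hρ : η < decreaseRatio f p (x k) (s k)
    · rw [(hrun.successful k hk.of_succ hρ).2]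
      have hpos := hrun.sigma_pos hσmin hγ₁ hk.of_succ
      -- The reset value `σmin` is the initial `σr 0`, hence at most `σ 0`.
      refine max_le (le_trans ?_ ih)
        ((hrun.sigmin_le fun j hj => hk j (hj.trans (Nat.zero_le _))).trans (le_max_left _ _))
      exact mul_le_of_le_one_left hpos.le hγ₂.le
    · rw [(hrun.unsuccessful k hk.of_succ hρ).2]
      exact (mul_le_mul_of_nonneg_left (hb k hk.of_succ hρ) (by linarith)).trans
        ((le_max_left _ _).trans (le_max_right _ _))

end Run

end ARpSoS

end

/-! ### The main theorem. -/

theorem mainTheorem7 (n p : ℕ) (hp : 4 ≤ p) (hpe : Even p) :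
    (∃ R : ℝ, ARpSoS.IsSoSRadius n p R) ∧
    ∀ (R : ℝ), ARpSoS.IsSoSRadius n p R →
    ∀ (f : EuclideanSpace ℝ (Fin n) → ℝ) (L : ℝ) (Λ : ℕ → ℝ)
      (ε a σmin η γ₁ γ₂ : ℝ)
      (x s : ℕ → EuclideanSpace ℝ (Fin n)) (σr σ c : ℕ → ℝ),
    ContDiff ℝ (p : ℕ∞) f →
    BddBelow (Set.range f) →
    0 < L →
    (∀ y z, ‖iteratedFDeriv ℝ p f y - iteratedFDeriv ℝ p f z‖ ≤
      ((p - 1).factorial : ℝ) * L * ‖y - z‖) →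
    0 < ε → ε < 1 → 0 ≤ a → a ≤ 1 / 2 →
    0 < σmin → 0 < η → η < 1 → 1 < γ₁ → 0 < γ₂ → γ₂ < 1 →
    ARpSoS.IsRun f p ε (ε ^ a) σmin η γ₁ γ₂ x s σr σ c →
    (∀ k, ARpSoS.Performed f ε x k → ∀ j ∈ Finset.Icc 1 p, ‖iteratedFDeriv ℝ j f (x k)‖ ≤ Λ j) →
    (∀ k, ARpSoS.Performed f ε x k →
      ARpSoS.SigmaBounds p ε a γ₁ (σ 0) (ARpSoS.constB' p L η Λ) (ARpSoS.constC p R Λ) (σ k)) ∧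
    ((∀ k, ARpSoS.Performed f ε x k → ¬ η < ARpSoS.decreaseRatio f p (x k) (s k) →
        ε < ‖gradient f (x k + s k)‖) →
      ∀ k, ARpSoS.Performed f ε x k →
        ARpSoS.SigmaBounds p ε a γ₁ (σ 0) (ARpSoS.constB p L η Λ) (ARpSoS.constC p R Λ) (σ k)) := by
  refine ⟨ARpSoS.exists_isSoSRadius n hpe, ?_⟩
  intro R hR f L Λ ε a σmin η γ₁ γ₂ x s σr σ c hf _ hL0 hL hε hε1 ha _ hσmin _ hη1 hγ₁ _ hγ₂
    hrun hΛ
  have hδ : 0 < ε ^ a := Real.rpow_pos_of_pos hε a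
  have hδ1 : ε ^ a ≤ 1 := Real.rpow_le_one hε.le hε1.le ha
  have hf2 : ContDiff ℝ ((2 : ℕ) : ℕ∞) f := hf.of_le (by exact_mod_cast (by omega : 2 ≤ p))
  have hA0 := ARpSoS.constA_pos hL0 hη1 hpe
  have bounds : ∀ B, (∀ k, ARpSoS.Performed f ε x k →
      ¬ η < ARpSoS.decreaseRatio f p (x k) (s k) → σ k ≤ B * ε⁻¹) →
      ∀ k, ARpSoS.Performed f ε x k →
        ARpSoS.SigmaBounds p ε a γ₁ (σ 0) B (ARpSoS.constC p R Λ) (σ k) := by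
    intro B hB k hk
    refine ARpSoS.sigmaBounds_of_le (by omega) hpe hε hε1
      (hrun.sigma_pos hσmin hγ₁ fun j hj => hk j (hj.trans (Nat.zero_le _))).le ?_
    rw [mul_assoc γ₁]
    exact hrun.sigma_le hσmin hγ₁ hγ₂ hB (fun j hj =>
      ARpSoS.sosSigma_le hp hpe hR hf (hΛ j hj) hδ (hrun.perturbation j hj)) hk
  have hc0 : ∀ k, ARpSoS.Performed f ε x k → 0 ≤ c k := fun k hk =>
    (hrun.perturbation k hk).nonneg hδ.le
  have hc1 : ∀ k, ARpSoS.Performed f ε x k → c k ≤ Λ 2 + 1 := fun k hk => by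
    have h2 := hΛ k hk 2 (Finset.mem_Icc.mpr ⟨by norm_num, by omega⟩)
    exact (hrun.perturbation k hk).le_add_one hδ1 ((norm_nonneg _).trans h2)
      ((neg_le_neg h2).trans (ARpSoS.neg_norm_le_hessianLambdaMin hf2 (x k)))
  have hgrad : ∀ k, ARpSoS.Performed f ε x k → ε < ‖fderiv ℝ f (x k)‖ := fun k hk => by
    rw [← ARpSoS.norm_gradient_eq_norm_fderiv]
    exact hk k le_rfl
  have hs0 : ∀ k, ARpSoS.Performed f ε x k → s k ≠ 0 := fun k hk =>
    ARpSoS.step_ne_zero (by omega) hpe hf (hrun.step_min k hk)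
      (norm_pos_iff.mp (hε.trans (hgrad k hk)))
  have hstep : ∀ k, ARpSoS.Performed f ε x k → ¬ η < ARpSoS.decreaseRatio f p (x k) (s k) →
      σ k * ‖s k‖ ≤ ARpSoS.constA p L η := fun k hk hρ =>
    ARpSoS.mul_norm_step_le_constA (by omega) hpe hL0 hf hL hη1 (hrun.sigma_pos hσmin hγ₁ hk)
      (hc0 k hk) (hrun.step_min k hk) (hs0 k hk) hρ
  refine ⟨bounds _ fun k hk hρ => ?_, fun htrial => bounds _ fun k hk hρ => ?_⟩
  · exact ARpSoS.le_constB'_mul_inv hp hpe hf (hΛ k hk) hε hε1 (hgrad k hk) hA0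
      (hrun.sigma_pos hσmin hγ₁ hk) (hc0 k hk) (hc1 k hk) (hrun.step_min k hk) (hstep k hk hρ)
  · have hx := htrial k hk hρ
    rw [ARpSoS.norm_gradient_eq_norm_fderiv] at hx
    exact ARpSoS.le_constB_mul_inv (by omega) hpe hL0 hf hL hε hε1 hx hA0
      (hrun.sigma_pos hσmin hγ₁ hk) (hc0 k hk) (hc1 k hk) (hrun.step_min k hk) (hs0 k hk)
      (hstep k hk hρ)
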